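/- Let $\mathbb F_q$ be a finite field with $q$ odd, let $\psi:\mathbb F_q\to\mathbb C^\times$ be a non-trivial additive character, and let $n\ge 0$. For a symplectic vector space $(V,\omega)$ over $\mathbb F_q$ of dimension $2n$, let $H(V)=V\times\mathbb F_q$ be the Heisenberg group, with product $(v,z)(v',z')=(v+v',\,z+z'+\tfrac12\omega(v,v'))$; regard the subspaces of $V$ as subsets of $H(V)$ via $v\mapsto(v,0)$. An oriented Lagrangian in $V$ is a pair $L^\circ=(L,o_L)$, where $L\subset V$ is a Lagrangian subspace and $0\ne o_L\in\bigwedge^{n}L$; the set of these is $OLag(V)$. For $L^\circ\in OLag(V)$ let $\mathcal H_{L^\circ}$ be the space of functions $f:H(V)\to\mathbb C$ with $f((0,z)h)=\psi(z)f(h)$ and $f(l h)=f(h)$ for all $z\in\mathbb F_q$, $l\in L$, $h\in H(V)$, on which $H(V)$ acts by right translation. A trivialization of the $H(V)$-vector bundle $\mathfrak H(V)=\{\mathcal H_{L^\circ}\}$ on $OLag(V)$ is a system of $H(V)$-equivariant linear isomorphisms $T_{M^\circ,L^\circ}:\mathcal H_{L^\circ}\to\mathcal H_{M^\circ}$, one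 for each $(M^\circ,L^\circ)\in OLag(V)^2$, such that $$T_{N^\circ,M^\circ}\circ T_{M^\circ,L^\circ}=T_{N^\circ,L^\circ}\qquad\text{for all } N^\circ,M^\circ,L^\circ\in OLag(V).$$ Let $\sigma$ be the quadratic character of $\mathbb F_q^\times$ and $G_1=\sum_{z\in\mathbb F_q}\psi(\tfrac12z^2)$. Let $\langle o_L,o_M\rangle\in\mathbb F_q$ denote the bilinear pairing of $\bigwedge^nL$ and $\bigwedge^nM$ given by $\langle l_1\wedge\dots\wedge l_n,\,m_1\wedge\dots\wedge m_n\rangle=\det(\omega(l_i,m_j))_{i,j}$. **Theorem (the strong Stone--von Neumann property).** Each bundle $\mathfrak H(V)$ admits a natural trivialization. Precisely, there are trivializations $T^V=\{T^V_{M^\circ,L^\circ}\}$ of $\mathfrak H(V)$, one for each symplectic vector space $V$ of dimension $2n$ over $\mathbb F_q$, such that: 1. (Naturality.) For every isomorphism $f:V\to W$ of symplectic vector spaces of dimension $2n$ and all $M^\circ,L^\circ\in OLag(V)$, $$T^V_{M^\circ,L^\circ}\circ f_{L^\circ}^*=f_{M^\circ}^*\circ T^W_{f(M^\circ),f(L^\circ)},$$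 where $f(L^\circ)=(f(L),\bigwedge^nf(o_L))$ and $f_{L^\circ}^*:\mathcal H_{f(L^\circ)}\to\mathcal H_{L^\circ}$ is the map $(f_{L^\circ}^*\varphi)(v,z)=\varphi(f(v),z)$. In particular, $T^V$ is $Sp(V)$-equivariant. 2. (Canonicity.) For every $V$, $T^V$ is the unique trivialization of $\mathfrak H(V)$ that on the pairs in general position is given by normalized averaging: for all $M^\circ,L^\circ\in OLag(V)$ with $L+M=V$, all $f\in\mathcal H_{L^\circ}$ and all $h\in H(V)$, $$T^V_{M^\circ,L^\circ}[f](h)=\Bigl(\frac{G_1}{q}\Bigr)^{n}\sigma\bigl(\langle o_L,o_M\rangle\bigr)\sum_{m\in M}f(m h).$$ -/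

import Mathlib

universe u v

/-- A symplectic vector space of dimension `2 * n` over the field `K`. -/
structure SympSpace (K : Type v) [Field K] (n : ℕ) where
  carrier : Type u
  [addCommGroup : AddCommGroup carrier]
  [module : Module K carrier]
  [finite : Module.Finite K carrier]
  form : LinearMap.BilinForm K carrier
  alt : form.IsAlt
  nondegenerate : form.Nondegenerate
  finrank_eq : Module.finrank K carrier = 2 * n

namespace SympSpace

variable {K : Type v} [Field K] {n : ℕ}

instance : CoeSort (SympSpace.{u} K n) (Type u) := ⟨SympSpace.carrier⟩

instance (V : SympSpace.{u} K n) : AddCommGroup V := V.addCommGroup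
instance (V : SympSpace.{u} K n) : Module K V := V.module
instance (V : SympSpace.{u} K n) : Module.Finite K V := V.finite

/-- Linear isomorphisms preserving the symplectic forms. -/
abbrev Iso (V W : SympSpace.{u} K n) : Type u :=
  LinearMap.BilinForm.IsometryEquiv V.form W.form

end SympSpace

/-- The underlying set `V × K` of the Heisenberg group of `V`. -/
@[ext]
structure Heis {K : Type v} [Field K] {n : ℕ} (V : SympSpace.{u} K n) where
  vec : V
  cen : K

namespace Heis

variable {K : Type v} [Field K] {n : ℕ} {V : SympSpace.{u} K n}

instance : Mul (Heis V) := ⟨fun g h => ⟨g.vec + h.vec, g.cen + h.cen + 2⁻¹ * V.form g.vec h.vec⟩⟩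
instance : One (Heis V) := ⟨⟨0, 0⟩⟩
instance : Inv (Heis V) := ⟨fun g => ⟨-g.vec, -g.cen⟩⟩

@[simp] theorem mul_vec (g h : Heis V) : (g * h).vec = g.vec + h.vec := rfl
@[simp] theorem mul_cen (g h : Heis V) :
    (g * h).cen = g.cen + h.cen + 2⁻¹ * V.form g.vec h.vec := rfl
@[simp] theorem one_vec : (1 : Heis V).vec = 0 := rfl
@[simp] theorem one_cen : (1 : Heis V).cen = 0 := rfl
@[simp] theorem inv_vec (g : Heis V) : g⁻¹.vec = -g.vec := rfl
@[simp] theorem inv_cen (g : Heis V) : g⁻¹.cen = -g.cen := rfl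

/-- The Heisenberg group: `(v, z) * (v', z') = (v + v', z + z' + ω(v, v') / 2)`. -/
instance : Group (Heis V) :=
  Group.ofLeftAxioms
    (by intro a b c; ext <;> simp [add_assoc]; ring)
    (by intro a; ext <;> simp)
    (by intro a; ext <;> simp [V.alt a.vec])

/-- The map of Heisenberg groups `(v, z) ↦ (f v, z)` induced by a symplectic isomorphism. -/
def map {V W : SympSpace.{u} K n} (f : V.Iso W) : Heis V →* Heis W where
  toFun h := ⟨f h.vec, h.cen⟩
  map_one' := by ext <;> simp
  map_mul' g h := by
    ext
    · simp
    · simp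

end Heis

/-- A subspace is Lagrangian if it is equal to its own orthogonal complement. -/
def IsLagrangian {K : Type v} [Field K] {n : ℕ} (V : SympSpace.{u} K n)
    (L : Submodule K V) : Prop :=
  V.form.orthogonal L = L

/-- Lagrangian subspaces have dimension `n`, so `⋀[K]^n L` is the top exterior power of `L`. -/
theorem IsLagrangian.finrank_eq {K : Type v} [Field K] {n : ℕ} {V : SympSpace.{u} K n}
    {L : Submodule K V} (hL : IsLagrangian V L) : Module.finrank K L = n := by
  have h := LinearMap.BilinForm.finrank_orthogonal V.nondegenerate L
  have hle := Submodule.finrank_le L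
  have h2 := V.finrank_eq
  rw [show V.form.orthogonal L = L from hL] at h
  omega

/-- Oriented Lagrangians: a Lagrangian `L` with a nonzero vector of its top exterior power. -/
structure OLag {K : Type v} [Field K] {n : ℕ} (V : SympSpace.{u} K n) where
  space : Submodule K V
  lagrangian : IsLagrangian V space
  orient : ⋀[K]^n space
  orient_ne_zero : orient ≠ 0

namespace OLag

variable {K : Type v} [Field K] {n : ℕ}

/-- The image `(f(L), ⋀ⁿf(o_L))` of an oriented Lagrangian under a symplectic isomorphism. -/
noncomputable def map {V W : SympSpace.{u} K n} (f : V.Iso W) (L : OLag V) : OLag W where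
  space := L.space.map (f.toLinearEquiv : V →ₗ[K] W)
  lagrangian := by
    have hL : V.form.orthogonal L.space = L.space := L.lagrangian
    have hf : ∀ x y, W.form (f.toLinearEquiv x) (f.toLinearEquiv y) = V.form x y := f.map_app'
    ext w
    obtain ⟨x, rfl⟩ := f.toLinearEquiv.surjective w
    have h1 : x ∈ V.form.orthogonal L.space ↔ x ∈ L.space := by rw [hL]
    have h2 : f.toLinearEquiv x ∈ L.space.map (f.toLinearEquiv : V →ₗ[K] W) ↔ x ∈ L.space :=
      f.toLinearEquiv.injective.mem_set_image (s := (L.space : Set V))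
    rw [h2, ← h1, LinearMap.BilinForm.mem_orthogonal_iff, LinearMap.BilinForm.mem_orthogonal_iff]
    constructor
    · intro h y hy
      exact (hf y x).symm.trans (h _ (Submodule.mem_map_of_mem hy))
    · rintro h _ ⟨y, hy, rfl⟩
      exact (hf y x).trans (h y hy)
  orient := exteriorPower.map n (f.toLinearEquiv.submoduleMap L.space).toLinearMap L.orient
  orient_ne_zero := by
    intro h
    refine L.orient_ne_zero (exteriorPower.map_injective_field
      (f.toLinearEquiv.submoduleMap L.space).injective ?_)
    rw [map_zero]
    exact h

variable {V : SympSpace.{u} K n}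

/-- The pairing of the orientations of `L` and `M` induced by the symplectic form. It is given by
`(l₁ ∧ ⋯ ∧ lₙ, m₁ ∧ ⋯ ∧ mₙ) ↦ det (ω(lᵢ, mⱼ))`. In terms of the pairing `ω_∧` that contracts the
innermost factors first, `ω_∧(l₁ ∧ ⋯ ∧ lₙ, m₁ ∧ ⋯ ∧ mₙ) = det (ω(lₙ₊₁₋ᵢ, mⱼ))`, this is
`(-1) ^ (n.choose 2) * ω_∧`. -/
noncomputable def pairing (L M : OLag V) : K :=
  exteriorPower.pairingDual K M.space n
    (exteriorPower.map n ((V.form.domRestrict₁₂ L.space M.space)) L.orient) M.orient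

end OLag

section Models

variable {K : Type v} [Field K] {n : ℕ} (V : SympSpace.{u} K n) (ψ : AddChar K ℂ)

/-- The space `ℋ_L` of functions on the Heisenberg group that are `ψ`-equivariant under left
translation by the center and invariant under left translation by `L`. -/
def lagModel (L : OLag V) : Submodule ℂ (Heis V → ℂ) where
  carrier := {f | (∀ (z : K) (h : Heis V), f (⟨0, z⟩ * h) = ψ z * f h) ∧
    ∀ l ∈ L.space, ∀ h : Heis V, f (⟨l, 0⟩ * h) = f h}
  add_mem' := by
    rintro f g ⟨hf, hf'⟩ ⟨hg, hg'⟩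
    refine ⟨fun z h => ?_, fun l hl h => ?_⟩
    · simp only [Pi.add_apply, hf, hg, mul_add]
    · simp only [Pi.add_apply, hf' l hl, hg' l hl]
  zero_mem' := by simp
  smul_mem' := by
    rintro c f ⟨hf, hf'⟩
    refine ⟨fun z h => ?_, fun l hl h => ?_⟩
    · simp only [Pi.smul_apply, hf, smul_eq_mul, mul_left_comm]
    · simp only [Pi.smul_apply, hf' l hl]

/-- The Heisenberg action on `ℋ_L` by right translation. -/
def lagRep (L : OLag V) : Representation ℂ (Heis V) (lagModel V ψ L) where
  toFun g :=
    { toFun := fun f => ⟨fun h => f.1 (h * g), by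
        refine ⟨fun z h => ?_, fun l hl h => ?_⟩
        · simpa only [mul_assoc] using f.2.1 z (h * g)
        · simpa only [mul_assoc] using f.2.2 l hl (h * g)⟩
      map_add' := fun _ _ => rfl
      map_smul' := fun _ _ => rfl }
  map_one' := by
    ext f h
    simp
  map_mul' g g' := by
    ext f h
    simp [mul_assoc]

/-- Trivializations of the `H(V)`-vector bundle `L ↦ ℋ_L` on the set of oriented Lagrangians:
multiplicative systems of intertwining isomorphisms `E M L : ℋ_L → ℋ_M`. -/
structure Trivialization where
  E : ∀ M L : OLag V, (lagRep V ψ L).Equiv (lagRep V ψ M)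
  comp : ∀ N M L : OLag V,
    (E N M).toIntertwiningMap.comp (E M L).toIntertwiningMap = (E N L).toIntertwiningMap

variable {V}

/-- The pull-back `ℋ_{f(L)}(W) → ℋ_L(V)` along a symplectic isomorphism `f : V ≃ W`. -/
def pullback {W : SympSpace.{u} K n} (f : V.Iso W) (L : OLag V) :
    lagModel W ψ (L.map f) →ₗ[ℂ] lagModel V ψ L where
  toFun φ := ⟨fun h => φ.1 (Heis.map f h), by
    refine ⟨fun z h => ?_, fun l hl h => ?_⟩
    · have h0 : Heis.map f ⟨0, z⟩ = ⟨0, z⟩ := by ext <;> simp [Heis.map]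
      beta_reduce
      rw [map_mul, h0]
      exact φ.2.1 z _
    · beta_reduce
      rw [map_mul]
      exact φ.2.2 (f l) (Submodule.mem_map_of_mem hl) _⟩
  map_add' _ _ := rfl
  map_smul' _ _ := rfl

variable [Fintype K] [DecidableEq K]

/-- The one-dimensional Gauss sum. -/
noncomputable def gaussSumOne : ℂ := ∑ z : K, ψ (2⁻¹ * z ^ 2)

/-- The normalization constant `A_{M,L} = (G₁ / q) ^ n * σ(det ω(o_L, o_M))`. -/
noncomputable def normConst (M L : OLag V) : ℂ :=
  (gaussSumOne ψ / (Fintype.card K : ℂ)) ^ n * (quadraticChar K (L.pairing M) : ℂ)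

variable {ψ}

/-- On pairs in general position the trivialization is given by normalized averaging:
`E M L f h = A_{M,L} * ∑_{m ∈ M} f (m * h)` (a finite sum, as `M` is finite). -/
def Trivialization.IsCanonical (T : Trivialization V ψ) : Prop :=
  ∀ M L : OLag V, L.space ⊔ M.space = ⊤ → ∀ (f : lagModel V ψ L) (h : Heis V),
    (T.E M L f).1 h = normConst ψ M L * ∑ᶠ m : M.space, f.1 (⟨m, 0⟩ * h)

end Models

/-- A system of trivializations, one for each symplectic space of dimension `2 * n`, is natural if
it is compatible with the pull-backs along all symplectic isomorphisms. In particular (`V = W`) each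
of them is then `Sp(V)`-equivariant. -/
def IsNaturalSystem {K : Type v} [Field K] {n : ℕ} {ψ : AddChar K ℂ}
    (T : ∀ V : SympSpace.{u} K n, Trivialization V ψ) : Prop :=
  ∀ (V W : SympSpace.{u} K n) (f : V.Iso W) (M L : OLag V) (φ : lagModel W ψ (L.map f)),
    (T V).E M L (pullback ψ f L φ) = pullback ψ f M ((T W).E (M.map f) (L.map f) φ)

/-! An `H(V)`-map out of `ℋ_L` is determined by the image of the delta function on `L`, and an
`L`-fixed element of `ℋ_M` by its value at `1`. Intertwiners `ℋ_L → ℋ_M` thus form at most a line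
(`intertwiningMap_ext`), and the averaging map is a nonzero point of it (`lagAvg_bijective`). Every
identity between intertwiners is an identity between numbers.

Uniqueness and naturality: any two Lagrangians have a common complement `N`
(`exists_common_transversal`), so `T_{M,L} = T_{M,N} ∘ T_{N,L}` is forced by the prescribed values,
and these are compatible with symplectic isomorphisms.

Existence: fix a base point `X` and scale the averaging map `ℋ_X → ℋ_L` to an isomorphism `t L` such
that normalized averaging carries `t L` to `t M` whenever `L + M = V` (`exists_flat_section`). Then
`T_{M,L} = t M ∘ (t L)⁻¹` is multiplicative by construction. The scalar is `G₁ ^ (-dim (L ∩ X)) *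
σ(d)`, with `d` a discriminant of the pair `(X, L)`: a Gram determinant on vectors outside `L ∩ X`,
corrected by the orientations and well defined modulo squares (`IsRelDisc.isSquare_mul`). A factor
`(G₁ / q) ^ n` is dropped, since it would cancel in `T_{M,L}`.

The required scalar identity is `normConst_mul_relConst`. Bases `e` of `L`, `f` of `M` and `x i • e
i + y i • f i` of `X` (`exists_normal_form`) split it into `n` one-dimensional identities, each
resting on `G₁ ^ 2 = σ(-1) * q` (`sum_addChar_line`). -/

open Module

/-! ### Linear algebra of Lagrangian subspaces. -/

section Lagrangians

variable {K : Type v} [Field K] {n : ℕ} {V : SympSpace.{u} K n}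

theorem SympSpace.form_swap (V : SympSpace.{u} K n) (v w : V) : V.form v w = -V.form w v := by
  rw [V.alt.neg_eq]

theorem IsLagrangian.form_eq_zero {L : Submodule K V} (hL : IsLagrangian V L) {v w : V}
    (hv : v ∈ L) (hw : w ∈ L) : V.form v w = 0 := by
  rw [← show V.form.orthogonal L = L from hL] at hw
  exact hw v hv

theorem IsLagrangian.mem_of_form_eq_zero {L : Submodule K V} (hL : IsLagrangian V L) {w : V}
    (h : ∀ v ∈ L, V.form v w = 0) : w ∈ L := by
  rw [← show V.form.orthogonal L = L from hL]
  exact h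

theorem isLagrangian_of_isotropic {L : Submodule K V} (h : ∀ v ∈ L, ∀ w ∈ L, V.form v w = 0)
    (hd : n ≤ finrank K L) : IsLagrangian V L := by
  have h1 : L ≤ V.form.orthogonal L := fun w hw v hv => h v hv w hw
  refine (Submodule.eq_of_le_of_finrank_le h1 ?_).symm
  have h2 := LinearMap.BilinForm.finrank_orthogonal V.nondegenerate L
  have h3 := V.finrank_eq
  omega

theorem inf_eq_bot_of_sup_eq_top {L M : Submodule K V} (hL : IsLagrangian V L)
    (hM : IsLagrangian V M) (h : L ⊔ M = ⊤) : L ⊓ M = ⊥ := by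
  have h1 := Submodule.finrank_sup_add_finrank_inf_eq L M
  rw [h, finrank_top, V.finrank_eq, hL.finrank_eq, hM.finrank_eq] at h1
  exact Submodule.finrank_eq_zero.mp (by omega)

/-- `L + M` is its own double orthogonal, and `(L + M)^⊥` lies in `L^⊥ ∩ M^⊥ = L ∩ M`. -/
theorem mem_sup_of_form_eq_zero {L M : Submodule K V} (hL : IsLagrangian V L)
    (hM : IsLagrangian V M) {v : V} (h : ∀ u ∈ L ⊓ M, V.form u v = 0) : v ∈ L ⊔ M := by
  rw [← LinearMap.BilinForm.orthogonal_orthogonal V.nondegenerate V.alt.isRefl (L ⊔ M)]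
  intro u hu
  refine h u ⟨hL.mem_of_form_eq_zero fun x hx => hu x (Submodule.mem_sup_left hx),
    hM.mem_of_form_eq_zero fun x hx => hu x (Submodule.mem_sup_right hx)⟩

end Lagrangians

/-! ### Rigidity of intertwiners, and the averaging maps. -/

section Intertwiners

variable {K : Type v} [Field K] {n : ℕ} {V : SympSpace.{u} K n} {ψ : AddChar K ℂ}

theorem Heis.mk_eq_mul (v : V) (z : K) : (⟨v, z⟩ : Heis V) = ⟨0, z⟩ * ⟨v, 0⟩ := by
  ext <;> simp

theorem lagModel_apply_mk {L : OLag V} (f : lagModel V ψ L) (v : V) (z : K) :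
    f.1 ⟨v, z⟩ = ψ z * f.1 ⟨v, 0⟩ := by
  rw [Heis.mk_eq_mul, f.2.1]

theorem lagModel_apply_add {L : OLag V} (f : lagModel V ψ L) {l : V} (hl : l ∈ L.space) (v : V) :
    f.1 ⟨l + v, 0⟩ = ψ (-(2⁻¹ * V.form l v)) * f.1 ⟨v, 0⟩ := by
  have h : (⟨l + v, 0⟩ : Heis V) = ⟨l, 0⟩ * ⟨v, -(2⁻¹ * V.form l v)⟩ := by ext <;> simp
  rw [h, f.2.2 l hl, lagModel_apply_mk]

theorem lagModel_ext {L : OLag V} {f g : lagModel V ψ L}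
    (h : ∀ v : V, f.1 ⟨v, 0⟩ = g.1 ⟨v, 0⟩) : f = g := by
  apply Subtype.ext
  funext ⟨v, z⟩
  rw [lagModel_apply_mk f, lagModel_apply_mk g, h]

open Classical in
/-- The function supported on `L × K` that is equal to `ψ` on the center. -/
noncomputable def lagDelta (ψ : AddChar K ℂ) (L : OLag V) : lagModel V ψ L :=
  ⟨fun h => if h.vec ∈ L.space then ψ h.cen else 0, by
    refine ⟨fun z h => ?_, fun l hl h => ?_⟩
    · simp [AddChar.map_add_eq_mul]
    · by_cases hh : h.vec ∈ L.space
      · simp [hh, Submodule.add_mem _ hl hh, L.lagrangian.form_eq_zero hl hh]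
      · simp [hh, Submodule.add_mem_iff_right _ hl]⟩

theorem lagDelta_apply_of_mem {L : OLag V} {h : Heis V} (hh : h.vec ∈ L.space) :
    (lagDelta ψ L).1 h = ψ h.cen := if_pos hh

theorem lagDelta_apply_of_not_mem {L : OLag V} {h : Heis V} (hh : h.vec ∉ L.space) :
    (lagDelta ψ L).1 h = 0 := if_neg hh

theorem lagRep_lagDelta {L : OLag V} {l : V} (hl : l ∈ L.space) :
    lagRep V ψ L ⟨l, 0⟩ (lagDelta ψ L) = lagDelta ψ L := by
  apply Subtype.ext
  funext h
  change (lagDelta ψ L).1 (h * ⟨l, 0⟩) = _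
  by_cases hh : h.vec ∈ L.space
  · rw [lagDelta_apply_of_mem hh, lagDelta_apply_of_mem (by simpa using add_mem hh hl)]
    simp [L.lagrangian.form_eq_zero hh hl]
  · rw [lagDelta_apply_of_not_mem hh, lagDelta_apply_of_not_mem]
    simpa [Submodule.add_mem_iff_left _ hl] using hh

/-- Functions in `ℋ_M` that are fixed by `L` and vanish at `1` are zero. -/
theorem lagModel_eq_zero_of_fixed (h2 : (2 : K) ≠ 0) (hψ : ψ ≠ 1) {L M : OLag V}
    (g : lagModel V ψ M) (hg : ∀ l ∈ L.space, lagRep V ψ M ⟨l, 0⟩ g = g)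
    (h1 : g.1 1 = 0) : g = 0 := by
  have hR : ∀ l ∈ L.space, ∀ h, g.1 (h * ⟨l, 0⟩) = g.1 h := fun l hl h =>
    congrFun (congrArg Subtype.val (hg l hl)) h
  refine lagModel_ext fun v => ?_
  change g.1 _ = 0
  -- On `M + L`, left `M`-invariance and right `L`-invariance reduce the value to the one at `1`.
  -- Elsewhere some `u ∈ M ∩ L` pairs nontrivially with `v`.
  by_cases hv : v ∈ M.space ⊔ L.space
  · obtain ⟨m, hm, l, hl, rfl⟩ := Submodule.mem_sup.mp hv
    rw [lagModel_apply_add g hm]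
    have := hR l hl 1
    rw [one_mul, h1] at this
    rw [this, mul_zero]
  · obtain ⟨u, hu, huv⟩ : ∃ u ∈ M.space ⊓ L.space, V.form u v ≠ 0 := by
      by_contra! h
      exact hv (mem_sup_of_form_eq_zero M.lagrangian L.lagrangian h)
    obtain ⟨a, ha⟩ := (AddChar.ne_one_iff).mp hψ
    -- Scaled so that moving `w` across `v` produces the central element `a` with `ψ a ≠ 1`; both
    -- invariances then give `g v = ψ a * g v`.
    set w : V := (-(a / V.form u v)) • u with hw
    have hwM : w ∈ M.space := Submodule.smul_mem _ _ hu.1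
    have hwL : w ∈ L.space := Submodule.smul_mem _ _ hu.2
    have hf : V.form w v = -a := by
      rw [hw, map_smul, LinearMap.smul_apply, smul_eq_mul]
      field_simp
    have e1 : g.1 (⟨v, 0⟩ * ⟨w, 0⟩) = ψ a * g.1 ⟨v, 0⟩ := by
      have : (⟨v, 0⟩ * ⟨w, 0⟩ : Heis V) = ⟨w, 0⟩ * ⟨v, a⟩ := by
        ext
        · simp [add_comm]
        · simp only [Heis.mul_cen, V.form_swap v w, hf]
          field_simp
          ring
      rw [this, g.2.2 w hwM, lagModel_apply_mk]
    rw [hR w hwL] at e1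
    have : (1 - ψ a) * g.1 ⟨v, 0⟩ = 0 := by linear_combination e1
    rcases mul_eq_zero.mp this with h | h
    · exact absurd (by linear_combination -h) ha
    · exact h

variable [Finite K]

instance (V : SympSpace.{u} K n) : Finite V := Module.finite_of_finite K

/-- The translates of `lagDelta` span `ℋ_L`. -/
theorem card_smul_eq_sum_lagRep_lagDelta {L : OLag V} (f : lagModel V ψ L) :
    (Nat.card L.space : ℂ) • f =
      ∑ᶠ v : V, f.1 ⟨v, 0⟩ • lagRep V ψ L ⟨-v, 0⟩ (lagDelta ψ L) := by
  classical
  have := Fintype.ofFinite V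
  rw [finsum_eq_sum_of_fintype]
  refine lagModel_ext fun w => ?_
  -- The nonzero summands do not depend on `v`, so the sum over the coset `w + L` gives the factor
  -- `|L|`.
  have key : ∀ v : V, f.1 ⟨v, 0⟩ * (lagDelta ψ L).1 (⟨w, 0⟩ * ⟨-v, 0⟩) =
      if w - v ∈ L.space then f.1 ⟨w, 0⟩ else 0 := by
    intro v
    by_cases h : w - v ∈ L.space
    · rw [if_pos h, lagDelta_apply_of_mem (by simpa [sub_eq_add_neg] using h)]
      conv_rhs => rw [← sub_add_cancel w v, lagModel_apply_add f h]
      simp [V.alt v, mul_comm]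
    · rw [if_neg h, lagDelta_apply_of_not_mem (by simpa [sub_eq_add_neg] using h), mul_zero]
  have e : (∑ v : V, f.1 ⟨v, 0⟩ • lagRep V ψ L ⟨-v, 0⟩ (lagDelta ψ L)).1 ⟨w, 0⟩ =
      ∑ v : V, f.1 ⟨v, 0⟩ * (lagDelta ψ L).1 (⟨w, 0⟩ * ⟨-v, 0⟩) := by
    rw [AddSubmonoidClass.coe_finsetSum, Finset.sum_apply]
    rfl
  rw [e, Finset.sum_congr rfl fun v _ => key v, ← Equiv.sum_comp (Equiv.subLeft w)]
  simp only [Equiv.subLeft_apply, sub_sub_cancel]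
  rw [← Finset.sum_filter, Finset.sum_const, nsmul_eq_mul]
  rw [Nat.card_eq_fintype_card, Fintype.card_subtype]
  rfl

/-- An intertwining map `ℋ_L → ℋ_M` is determined by one value. -/
theorem intertwiningMap_ext (h2 : (2 : K) ≠ 0) (hψ : ψ ≠ 1) {L M : OLag V}
    {φ φ' : (lagRep V ψ L).IntertwiningMap (lagRep V ψ M)}
    (h : (φ (lagDelta ψ L)).1 1 = (φ' (lagDelta ψ L)).1 1) : φ = φ' := by
  have hfix : φ (lagDelta ψ L) - φ' (lagDelta ψ L) = 0 := by
    refine lagModel_eq_zero_of_fixed (L := L) h2 hψ _ (fun l hl => ?_) (sub_eq_zero.mpr h)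
    rw [map_sub, ← φ.isIntertwining, ← φ'.isIntertwining, lagRep_lagDelta hl]
  apply DFunLike.ext
  intro f
  have := Fintype.ofFinite V
  have hc : (Nat.card L.space : ℂ) ≠ 0 := by exact_mod_cast Nat.card_pos.ne'
  apply smul_right_injective _ hc
  beta_reduce
  rw [← map_smul, ← map_smul, card_smul_eq_sum_lagRep_lagDelta, finsum_eq_sum_of_fintype,
    map_sum, map_sum]
  refine Finset.sum_congr rfl fun v _ => ?_
  rw [map_smul, map_smul, φ.isIntertwining, φ'.isIntertwining, sub_eq_zero.mp hfix]

/-- The averaging map `ℋ_L → ℋ_M`. -/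
noncomputable def lagAvg (ψ : AddChar K ℂ) (M L : OLag V) :
    (lagRep V ψ L).IntertwiningMap (lagRep V ψ M) :=
  LinearMap.intertwiningMap_of_isIntertwiningMap (lagRep V ψ L) (lagRep V ψ M)
    { toFun f := ⟨fun h => ∑ᶠ m : M.space, f.1 (⟨m, 0⟩ * h), by
        refine ⟨fun z h => ?_, fun l hl h => ?_⟩
        · beta_reduce
          rw [mul_finsum' _ _ (Set.toFinite _)]
          refine finsum_congr fun m => ?_
          rw [← f.2.1, ← mul_assoc, ← mul_assoc]
          refine congrArg f.1 (congrArg (· * h) ?_)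
          ext <;> simp
        · beta_reduce
          refine Eq.trans ?_ (finsum_comp_equiv (Equiv.addRight (⟨l, hl⟩ : M.space)))
          refine finsum_congr fun m => ?_
          rw [← mul_assoc]
          refine congrArg f.1 (congrArg (· * h) ?_)
          ext
          · simp
          · simp [M.lagrangian.form_eq_zero m.2 hl]⟩
      map_add' f g := by
        apply Subtype.ext
        funext h
        exact finsum_add_distrib (Set.toFinite _) (Set.toFinite _)
      map_smul' c f := by
        apply Subtype.ext
        funext h
        exact (mul_finsum' _ _ (Set.toFinite _)).symm }
    (by
      intro g f
      apply Subtype.ext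
      funext h
      refine finsum_congr fun m => ?_
      exact congrArg f.1 (mul_assoc _ _ _))

theorem lagAvg_apply (M L : OLag V) (f : lagModel V ψ L) (h : Heis V) :
    (lagAvg ψ M L f).1 h = ∑ᶠ m : M.space, f.1 (⟨m, 0⟩ * h) := rfl

theorem lagAvg_lagDelta (M L : OLag V) :
    (lagAvg ψ M L (lagDelta ψ L)).1 1 = Nat.card ↥(M.space ⊓ L.space) := by
  classical
  have := Fintype.ofFinite M.space
  rw [lagAvg_apply, finsum_eq_sum_of_fintype]
  have : ∀ m : M.space, (lagDelta ψ L).1 (⟨m, 0⟩ * 1) = if (m : V) ∈ L.space then 1 else 0 := by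
    intro m
    split_ifs with h
    · rw [lagDelta_apply_of_mem (by simpa using h)]
      simp
    · rw [lagDelta_apply_of_not_mem (by simpa using h)]
  rw [Finset.sum_congr rfl fun m _ => this m, Finset.sum_boole, ← Fintype.card_subtype,
    ← Nat.card_eq_fintype_card]
  congr 1
  exact Nat.card_congr ((Equiv.subtypeSubtypeEquivSubtypeInter (· ∈ M.space) (· ∈ L.space)))

/-- The average of `lagDelta ψ L` is still fixed by right translation by `L`, so all `|L|` terms of
the outer sum equal its value at `1`. -/
theorem lagAvg_comp_lagAvg_lagDelta (M L : OLag V) :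
    (lagAvg ψ L M (lagAvg ψ M L (lagDelta ψ L))).1 1 =
      Nat.card L.space * Nat.card ↥(M.space ⊓ L.space) := by
  have := Fintype.ofFinite L.space
  rw [lagAvg_apply, finsum_eq_sum_of_fintype]
  have : ∀ l : L.space, (lagAvg ψ M L (lagDelta ψ L)).1 (⟨l, 0⟩ * 1) =
      Nat.card ↥(M.space ⊓ L.space) := by
    intro l
    rw [← lagAvg_lagDelta (ψ := ψ), mul_one]
    have h := (lagAvg ψ M L).isIntertwining _ _ (⟨l, 0⟩ : Heis V) (lagDelta ψ L)
    rw [lagRep_lagDelta l.2] at h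
    conv_rhs => rw [h]
    change _ = (lagAvg ψ M L (lagDelta ψ L)).1 ((1 : Heis V) * ⟨l, 0⟩)
    rw [one_mul]
  rw [Finset.sum_congr rfl fun l _ => this l, Finset.sum_const, nsmul_eq_mul,
    Finset.card_univ, Nat.card_eq_fintype_card (α := L.space)]

/-- By rigidity the composite is the scalar read off at `lagDelta` and `1`, a product of two
positive cardinalities. -/
theorem exists_lagAvg_comp_lagAvg (h2 : (2 : K) ≠ 0) (hψ : ψ ≠ 1) (M L : OLag V) :
    ∃ c : ℂ, c ≠ 0 ∧ ∀ f, lagAvg ψ L M (lagAvg ψ M L f) = c • f := by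
  refine ⟨Nat.card L.space * Nat.card ↥(M.space ⊓ L.space), ?_, fun f => ?_⟩
  · exact mul_ne_zero (by exact_mod_cast Nat.card_pos.ne') (by exact_mod_cast Nat.card_pos.ne')
  · set c : ℂ := Nat.card L.space * Nat.card ↥(M.space ⊓ L.space) with hc
    let ζ : (lagRep V ψ L).IntertwiningMap (lagRep V ψ L) :=
      LinearMap.intertwiningMap_of_isIntertwiningMap (lagRep V ψ L) (lagRep V ψ L)
        (c • LinearMap.id) (fun g v => (map_smul (lagRep V ψ L g) c v).symm)
    have h : (lagAvg ψ L M).comp (lagAvg ψ M L) = ζ := by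
      refine intertwiningMap_ext h2 hψ ?_
      change (lagAvg ψ L M (lagAvg ψ M L (lagDelta ψ L))).1 1 = c * (lagDelta ψ L).1 1
      rw [lagAvg_comp_lagAvg_lagDelta, lagDelta_apply_of_mem (zero_mem _)]
      simp [hc]
    exact DFunLike.congr_fun h f

theorem lagAvg_bijective (h2 : (2 : K) ≠ 0) (hψ : ψ ≠ 1) (M L : OLag V) :
    Function.Bijective (lagAvg ψ M L) := by
  constructor
  · obtain ⟨c, hc, h⟩ := exists_lagAvg_comp_lagAvg h2 hψ M L
    intro f g hfg
    have := congrArg (lagAvg ψ L M) hfg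
    rw [h, h] at this
    exact smul_right_injective _ hc this
  · obtain ⟨c, hc, h⟩ := exists_lagAvg_comp_lagAvg h2 hψ L M
    intro g
    exact ⟨c⁻¹ • lagAvg ψ L M g, by rw [map_smul, h, smul_smul, inv_mul_cancel₀ hc, one_smul]⟩

end Intertwiners

/-! ### Complements of Lagrangians and normal forms of triples. -/

section SymplecticGeometry

variable {K : Type v} [Field K] {n : ℕ} {V : SympSpace.{u} K n}

theorem exists_dualEquiv_of_isCompl {L C : Submodule K V} (hL : IsLagrangian V L)
    (h : IsCompl L C) : ∃ τ : L ≃ₗ[K] Dual K C, ∀ l c, τ l c = V.form l c := by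
  have hinj : Function.Injective (V.form.domRestrict₁₂ L C) := by
    rw [injective_iff_map_eq_zero]
    intro l hl
    have h0 : ∀ w, V.form w l = 0 := by
      intro w
      obtain ⟨a, ha, c, hc, rfl⟩ := Submodule.mem_sup.mp (h.sup_eq_top ▸ Submodule.mem_top (x := w))
      rw [map_add, LinearMap.add_apply, hL.form_eq_zero ha l.2, zero_add, V.form_swap]
      have : V.form l c = 0 := LinearMap.congr_fun hl ⟨c, hc⟩
      rw [this, neg_zero]
    apply Subtype.ext
    exact V.nondegenerate.2 _ h0
  have hd : finrank K L = finrank K (Dual K C) := by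
    have := Submodule.finrank_add_eq_of_isCompl h
    rw [V.finrank_eq, hL.finrank_eq] at this
    rw [Subspace.dual_finrank_eq, hL.finrank_eq]
    omega
  exact ⟨LinearEquiv.ofInjectiveOfFinrankEq _ hinj hd, fun _ _ => rfl⟩

theorem IsLagrangian.isCompl {L M : Submodule K V} (hL : IsLagrangian V L)
    (hM : IsLagrangian V M) (h : L ⊔ M = ⊤) : IsCompl L M :=
  IsCompl.of_eq (inf_eq_bot_of_sup_eq_top hL hM h) h

theorem exists_isLagrangian_sup_eq_top (h2 : (2 : K) ≠ 0) {L : Submodule K V}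
    (hL : IsLagrangian V L) : ∃ M, IsLagrangian V M ∧ L ⊔ M = ⊤ := by
  obtain ⟨C, hC⟩ := Submodule.exists_isCompl L
  obtain ⟨τ, hτ⟩ := exists_dualEquiv_of_isCompl hL hC
  -- An arbitrary complement `C` is sheared along `L`: each of the two cross terms in `ω(c + S c, c'
  -- + S c')` cancels half of `ω(c, c')`, so the graph of `S` is isotropic.
  let S : C →ₗ[K] L := τ.symm.toLinearMap ∘ₗ ((-2⁻¹ : K) • V.form.domRestrict₁₂ C C)
  have hS : ∀ c c' : C, V.form (S c) c' = -2⁻¹ * V.form c c' := by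
    intro c c'
    rw [← hτ, LinearMap.comp_apply, LinearEquiv.coe_coe, LinearEquiv.apply_symm_apply]
    rfl
  let g : C →ₗ[K] V := C.subtype + L.subtype ∘ₗ S
  have hg : ∀ c, g c = c + S c := fun _ => rfl
  have hdisj := hC.disjoint
  have hinj : Function.Injective g := by
    rw [injective_iff_map_eq_zero]
    intro c hc
    have : (c : V) = ((-S c : L) : V) := by
      rw [hg] at hc
      rw [Submodule.coe_neg]
      exact eq_neg_of_add_eq_zero_left hc
    exact Subtype.ext (Submodule.disjoint_def.mp hdisj c (this ▸ (-S c).2) c.2)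
  refine ⟨LinearMap.range g, isLagrangian_of_isotropic ?_ ?_, ?_⟩
  · rintro _ ⟨c, rfl⟩ _ ⟨c', rfl⟩
    rw [hg, hg]
    simp only [map_add, LinearMap.add_apply]
    rw [hS, hL.form_eq_zero (S c).2 (S c').2, V.form_swap c (S c'), hS, V.form_swap c' c]
    field_simp
    ring
  · rw [LinearMap.finrank_range_of_inj hinj]
    have := Submodule.finrank_add_eq_of_isCompl hC
    rw [V.finrank_eq, hL.finrank_eq] at this
    omega
  · rw [eq_top_iff, ← hC.sup_eq_top]
    refine sup_le le_sup_left fun c hc => ?_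
    have : c = -(S ⟨c, hc⟩ : V) + g ⟨c, hc⟩ := by rw [hg]; simp
    rw [this]
    exact Submodule.add_mem_sup (neg_mem (S ⟨c, hc⟩).2) ⟨_, rfl⟩

theorem exists_dual_basis {ι : Type*} [Finite ι] [DecidableEq ι] {L M : Submodule K V}
    (hL : IsLagrangian V L) (hM : IsLagrangian V M) (h : L ⊔ M = ⊤) (e : Basis ι K L) :
    ∃ f : Basis ι K M, ∀ i j, V.form (e i) (f j) = if i = j then 1 else 0 := by
  obtain ⟨τ, hτ⟩ := exists_dualEquiv_of_isCompl hM (hL.isCompl hM h).symm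
  -- The sign is needed because `τ` pairs `M` with `L` in the opposite order.
  refine ⟨e.dualBasis.map ((LinearEquiv.neg K).trans τ.symm), fun i j => ?_⟩
  rw [V.form_swap, ← hτ]
  simp [Finsupp.single_apply]

/-- Simultaneous normal form of a pair of transversal Lagrangians and a third Lagrangian. -/
theorem exists_normal_form (h2 : (2 : K) ≠ 0) {L M X : Submodule K V}
    (hL : IsLagrangian V L) (hM : IsLagrangian V M) (hX : IsLagrangian V X) (h : L ⊔ M = ⊤) :
    ∃ (e : Basis (Fin n) K L) (f : Basis (Fin n) K M) (g : Basis (Fin n) K X)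
      (x y : Fin n → K), (∀ i j, V.form (e i) (f j) = if i = j then 1 else 0) ∧
      (∀ i, (g i : V) = x i • (e i : V) + y i • (f i : V)) ∧
      ∀ i, x i = 1 ∨ (x i = 0 ∧ y i = 1) := by
  have hc := hL.isCompl hM h
  let pl : V →ₗ[K] L := L.projectionOnto M hc
  let pm : V →ₗ[K] M := M.projectionOnto L hc.symm
  have hp : ∀ v : V, (pl v : V) + pm v = v := fun v =>
    Submodule.projection_add_projection_eq_self hc v
  let φ : X →ₗ[K] L := pl ∘ₗ X.subtype
  obtain ⟨r, hr⟩ := φ.rangeRestrict.exists_rightInverse_of_surjective φ.range_rangeRestrict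
  let U := LinearMap.range φ
  have hr' : ∀ t : U, pl (r t) = t := fun t => congrArg Subtype.val (LinearMap.congr_fun hr t)
  -- `X` lies over its projection `U` to `L` like the graph of a quadratic form. Isotropy of `X`
  -- makes `β` symmetric and independent of the section `r`, so `β` can be diagonalized.
  let β : LinearMap.BilinForm K U :=
    V.form.compl₁₂ (L.subtype ∘ₗ U.subtype) (M.subtype ∘ₗ pm ∘ₗ X.subtype ∘ₗ r)
  have hβ : ∀ s t : U, β s t = V.form (s : L) (pm (r t)) := fun _ _ => rfl
  have hXv : ∀ v ∈ X, ∀ s : U, V.form (s : L) (pm v) = V.form (pl v) (pm (r s)) := by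
    intro v hv s
    have h0 := hX.form_eq_zero (r s).2 hv
    rw [← hp v, ← hp (r s), hr'] at h0
    simp only [map_add, LinearMap.add_apply] at h0
    rw [hL.form_eq_zero (s : L).2 (pl v).2, hM.form_eq_zero (pm (r s)).2 (pm v).2,
      V.form_swap (pm (r s))] at h0
    linear_combination h0
  have hsymm : LinearMap.IsSymm β := ⟨fun s t => by
    rw [RingHom.id_apply, hβ, hβ, hXv _ (r t).2 s, hr']⟩
  have hβv : ∀ (v : V) (hv : v ∈ X) (s : U), V.form (s : L) (pm v) = β s ⟨φ ⟨v, hv⟩, ⟨_, rfl⟩⟩ := by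
    intro v hv s
    have h1 := hsymm.eq ⟨φ ⟨v, hv⟩, ⟨_, rfl⟩⟩ s
    rw [RingHom.id_apply] at h1
    rw [← h1, hXv v hv s]
    rfl
  have := invertibleOfNonzero h2
  obtain ⟨u, hu⟩ := LinearMap.BilinForm.exists_orthogonal_basis hsymm
  obtain ⟨W, hW⟩ := Submodule.exists_isCompl U
  let e : Basis (Fin (finrank K U) ⊕ Fin (finrank K W)) K L :=
    (u.prod (finBasis K W)).map (Submodule.prodEquivOfIsCompl U W hW)
  have heu : ∀ i, e (Sum.inl i) = u i := fun i => by simp [e]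
  obtain ⟨f, hf⟩ := exists_dual_basis hL hM h e
  let x : Fin (finrank K U) ⊕ Fin (finrank K W) → K := Sum.elim (fun _ => 1) (fun _ => 0)
  let y : Fin (finrank K U) ⊕ Fin (finrank K W) → K :=
    Sum.elim (fun i => β (u i) (u i)) (fun _ => 1)
  have hUr : ∀ (t : U) j, V.form (t : L) (f (Sum.inr j)) = 0 := by
    intro t j
    have : (V.form.flip (f (Sum.inr j))) ∘ₗ L.subtype ∘ₗ U.subtype = 0 := u.ext fun i => by
      simp [← heu, hf]
    exact LinearMap.congr_fun this t
  have hUl : ∀ (t : U) j, V.form (t : L) (f (Sum.inl j)) = u.repr t j := by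
    intro t j
    have : (V.form.flip (f (Sum.inl j))) ∘ₗ L.subtype ∘ₗ U.subtype = u.coord j := u.ext fun i => by
      simp [← heu, hf, Finsupp.single_apply]
    exact LinearMap.congr_fun this t
  have hβr : ∀ (t : U) j, β (u j) t = β (u j) (u j) * u.repr t j := by
    intro t j
    have : β (u j) = β (u j) (u j) • u.coord j := u.ext fun i => by
      by_cases hij : j = i
      · simp [hij]
      · simp [(LinearMap.isOrthoᵢ_def.mp hu) j i hij, Ne.symm hij]
    exact LinearMap.congr_fun this t
  -- By maximality of `X`, orthogonality to `X` suffices. For `inr`, `f` annihilates `U`; for `inl`,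
  -- this is the diagonal form of `β`.
  have hmem : ∀ i, x i • (e i : V) + y i • (f i : V) ∈ X := by
    intro i
    refine hX.mem_of_form_eq_zero fun v hv => ?_
    have hf' : ∀ j, V.form v (f j) = V.form (φ ⟨v, hv⟩) (f j) := by
      intro j
      conv_lhs => rw [← hp v]
      rw [map_add, LinearMap.add_apply, hM.form_eq_zero (pm v).2 (f j).2, add_zero]
      rfl
    cases i with
    | inr j =>
      simp only [x, y, Sum.elim_inr, zero_smul, one_smul, zero_add]
      rw [hf']
      exact hUr ⟨φ ⟨v, hv⟩, ⟨_, rfl⟩⟩ j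
    | inl j =>
      simp only [x, y, Sum.elim_inl, one_smul, map_add, map_smul, smul_eq_mul]
      have h1 : V.form (u j : L) v = V.form (u j : L) (pm v) := by
        conv_lhs => rw [← hp v]
        rw [map_add, hL.form_eq_zero (u j : L).2 (pl v).2, zero_add]
      rw [hf', hUl ⟨φ ⟨v, hv⟩, ⟨_, rfl⟩⟩ j, V.form_swap, ← hβr, ← hβv, heu, h1]
      ring
  have hxy : ∀ i, x i = 1 ∨ (x i = 0 ∧ y i = 1) := by
    rintro (i | i) <;> simp [x, y]
  let g0 : Fin (finrank K U) ⊕ Fin (finrank K W) → X :=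
    fun i => ⟨x i • (e i : V) + y i • (f i : V), hmem i⟩
  have hli : LinearIndependent K g0 := by
    rw [Fintype.linearIndependent_iff]
    intro a ha i
    have ha' : ∑ j, a j • (x j • (e j : V) + y j • (f j : V)) = 0 := by
      have := congrArg Subtype.val ha
      simpa [g0] using this
    rcases hxy i with hi | ⟨_, hi⟩
    · have := congrArg (fun v => V.form v (f i)) ha'
      simpa [hf, hM.form_eq_zero (f _).2 (f i).2, hi, -Fintype.sum_sum_type] using this
    · have := congrArg (fun v => V.form (e i) v) ha'
      simpa [hf, hL.form_eq_zero (e i).2 (e _).2, hi, -Fintype.sum_sum_type] using this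
  have hcard : Fintype.card (Fin (finrank K U) ⊕ Fin (finrank K W)) = n := by
    rw [← finrank_eq_card_basis e, hL.finrank_eq]
  let g := basisOfLinearIndependentOfCardEqFinrank' g0 hli (by rw [hcard, hX.finrank_eq])
  have hg : ∀ i, (g i : V) = x i • (e i : V) + y i • (f i : V) := fun i => by
    simp [g, g0]
  let ε := Fintype.equivFinOfCardEq hcard
  refine ⟨e.reindex ε, f.reindex ε, g.reindex ε, x ∘ ε.symm, y ∘ ε.symm, fun i j => ?_,
    fun i => ?_, fun i => hxy _⟩
  · simp [hf]
  · simp [hg]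

theorem isLagrangian_span {w : Fin n → V} (hw : LinearIndependent K w)
    (h : ∀ i j, V.form (w i) (w j) = 0) : IsLagrangian V (Submodule.span K (Set.range w)) := by
  refine isLagrangian_of_isotropic ?_ ?_
  · have h1 : ∀ i, ∀ b ∈ Submodule.span K (Set.range w), V.form (w i) b = 0 := by
      intro i b hb
      have : Submodule.span K (Set.range w) ≤ LinearMap.ker (V.form (w i)) := by
        rw [Submodule.span_le]
        rintro _ ⟨j, rfl⟩
        exact h i j
      exact this hb
    intro a ha b hb
    have : Submodule.span K (Set.range w) ≤ LinearMap.ker (V.form.flip b) := by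
      rw [Submodule.span_le]
      rintro _ ⟨j, rfl⟩
      exact h1 j b hb
    exact this ha
  · rw [finrank_span_eq_card hw, Fintype.card_fin]

/-- Any two Lagrangians have a common complementary Lagrangian. -/
theorem exists_common_transversal (h2 : (2 : K) ≠ 0) {L X : Submodule K V}
    (hL : IsLagrangian V L) (hX : IsLagrangian V X) :
    ∃ N, IsLagrangian V N ∧ L ⊔ N = ⊤ ∧ X ⊔ N = ⊤ := by
  classical
  obtain ⟨M, hM, hLM⟩ := exists_isLagrangian_sup_eq_top h2 hL
  obtain ⟨e, f, g, x, y, hef, hg, hxy⟩ := exists_normal_form h2 hL hM hX hLM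
  -- The complement will be spanned by `e i + z i • f i`. It is transversal to `L` when all `z i ≠
  -- 0`, and to `X` when all determinants `y i - x i * z i` are nonzero. Since `1 ≠ -1`, one of
  -- these two values works.
  have hz : ∀ i, ∃ z : K, z ≠ 0 ∧ y i - x i * z ≠ 0 := by
    intro i
    rcases hxy i with hx | ⟨hx, hy⟩
    · by_cases hy : y i = 1
      · refine ⟨-1, by simp, ?_⟩
        rw [hx, hy]
        intro h0
        exact h2 (by linear_combination h0)
      · exact ⟨1, one_ne_zero, by rw [hx, one_mul]; exact sub_ne_zero.mpr hy⟩
    · exact ⟨1, one_ne_zero, by simp [hx, hy]⟩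
  choose z hz0 hz1 using hz
  let w : Fin n → V := fun i => (e i : V) + z i • (f i : V)
  have hew : ∀ i j, V.form (e i) (w j) = if i = j then z j else 0 := by
    intro i j
    simp [w, hef, hL.form_eq_zero (e i).2 (e j).2]
  have hwf : ∀ i j, V.form (w i) (f j) = if i = j then 1 else 0 := by
    intro i j
    simp [w, hef, hM.form_eq_zero (f i).2 (f j).2]
  have hli : LinearIndependent K w := by
    rw [Fintype.linearIndependent_iff]
    intro a ha i
    have := congrArg (fun v => V.form v (f i)) ha
    simpa [hwf] using this
  have hmem : ∀ i, w i ∈ Submodule.span K (Set.range w) := fun i =>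
    Submodule.subset_span ⟨i, rfl⟩
  have htop : ∀ Y : Submodule K V, (∀ i, (e i : V) ∈ Y) → (∀ i, (f i : V) ∈ Y) → Y = ⊤ := by
    intro Y he hf
    rw [eq_top_iff, ← hLM]
    refine sup_le ?_ ?_
    · have := e.span_eq
      rw [← Submodule.map_subtype_top L, ← this, Submodule.map_span, Submodule.span_le]
      rintro _ ⟨_, ⟨i, rfl⟩, rfl⟩
      exact he i
    · have := f.span_eq
      rw [← Submodule.map_subtype_top M, ← this, Submodule.map_span, Submodule.span_le]
      rintro _ ⟨_, ⟨i, rfl⟩, rfl⟩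
      exact hf i
  refine ⟨Submodule.span K (Set.range w), isLagrangian_span hli fun i j => ?_, ?_, ?_⟩
  · have h1 : V.form (w i) (w j) = V.form (e i) (w j) - z i * V.form (w j) (f i) := by
      have : V.form (w i) = V.form (e i) + z i • V.form (f i) := by simp [w]
      rw [V.form_swap (w j), this, LinearMap.add_apply, LinearMap.smul_apply, smul_eq_mul]
      ring
    rw [h1, hew, hwf]
    by_cases hij : i = j
    · simp [hij]
    · simp [hij, Ne.symm hij]
  · refine htop _ (fun i => Submodule.mem_sup_left (e i).2) fun i => ?_
    have : (f i : V) = -((z i)⁻¹ • (e i : V)) + (z i)⁻¹ • w i := by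
      simp [w, smul_smul, hz0 i]
    rw [this]
    exact Submodule.add_mem_sup (neg_mem (Submodule.smul_mem _ _ (e i).2))
      (Submodule.smul_mem _ _ (hmem i))
  · have hf : ∀ i, (f i : V) ∈ X ⊔ Submodule.span K (Set.range w) := by
      intro i
      have h1 : (y i - x i * z i) • (f i : V) = (g i : V) + -(x i • w i) := by
        rw [hg, sub_smul, smul_add, smul_smul]
        abel
      rw [← inv_smul_smul₀ (hz1 i) (f i : V), h1]
      exact Submodule.smul_mem _ _ (Submodule.add_mem_sup (g i).2
        (neg_mem (Submodule.smul_mem _ _ (hmem i))))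
    refine htop _ (fun i => ?_) hf
    have : (e i : V) = w i - z i • (f i : V) := by simp [w]
    rw [this]
    exact sub_mem (Submodule.mem_sup_right (hmem i)) (Submodule.smul_mem _ _ (hf i))

end SymplecticGeometry

/-! ### Orientations as volume forms. -/

section Volume

variable {K : Type v} [Field K] {n : ℕ} {V : SympSpace.{u} K n}

theorem OLag.exists_vol (L : OLag V) :
    ∃ vol : L.space [⋀^Fin n]→ₗ[K] K, ∀ b, exteriorPower.ιMulti K n b = vol b • L.orient := by
  have h1 : finrank K (⋀[K]^n L.space) = 1 := by
    rw [exteriorPower.finrank_eq, L.lagrangian.finrank_eq, Nat.choose_self]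
  obtain ⟨ℓ, hℓ⟩ := Module.Projective.exists_dual_eq_one K L.orient_ne_zero
  refine ⟨ℓ.compAlternatingMap (exteriorPower.ιMulti K n), fun b => ?_⟩
  obtain ⟨c, hc⟩ := (finrank_eq_one_iff_of_nonzero' _ L.orient_ne_zero).mp h1
    (exteriorPower.ιMulti K n b)
  rw [LinearMap.compAlternatingMap_apply, ← hc, map_smul, hℓ, smul_eq_mul, mul_one]

/-- The volume form on `L` with value `1` on the orientation. -/
noncomputable def OLag.vol (L : OLag V) : L.space [⋀^Fin n]→ₗ[K] K := L.exists_vol.choose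

theorem OLag.ιMulti_eq_vol_smul (L : OLag V) (b : Fin n → L.space) :
    exteriorPower.ιMulti K n b = L.vol b • L.orient := L.exists_vol.choose_spec b

theorem OLag.vol_eq_mul_det (L : OLag V) (b : Basis (Fin n) K L.space) (b' : Fin n → L.space) :
    L.vol b' = L.vol b * b.det b' := by
  conv_lhs => rw [L.vol.eq_smul_basis_det b]
  rfl

theorem OLag.vol_basis_ne_zero (L : OLag V) (b : Basis (Fin n) K L.space) : L.vol b ≠ 0 := by
  intro h
  have h0 : ∀ b', exteriorPower.ιMulti K n (M := L.space) b' = 0 := fun b' => by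
    rw [L.ιMulti_eq_vol_smul, L.vol_eq_mul_det b, h, zero_mul, zero_smul]
  have h1 := exteriorPower.ιMulti_span K n L.space
  have h2 : Submodule.span K (Set.range (exteriorPower.ιMulti K n (M := L.space))) = ⊥ := by
    rw [Submodule.span_eq_bot]
    rintro _ ⟨b', rfl⟩
    exact h0 b'
  have h3 : L.orient ∈ (⊤ : Submodule K (⋀[K]^n L.space)) := Submodule.mem_top
  rw [← h1, h2] at h3
  exact L.orient_ne_zero h3

/-- This reduces the pairing of orientations to Gram determinants in bases; exterior powers are no
longer needed for computing it. -/
theorem OLag.vol_mul_vol_mul_pairing (L M : OLag V) (b : Fin n → L.space) (c : Fin n → M.space) :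
    L.vol b * M.vol c * L.pairing M = Matrix.det (.of fun i j => V.form (b i) (c j)) := by
  have h : exteriorPower.pairingDual K M.space n
      (exteriorPower.map n (V.form.domRestrict₁₂ L.space M.space)
        (exteriorPower.ιMulti K n b)) (exteriorPower.ιMulti K n c) =
      L.vol b * M.vol c * L.pairing M := by
    rw [L.ιMulti_eq_vol_smul, M.ιMulti_eq_vol_smul, map_smul, map_smul, map_smul,
      LinearMap.smul_apply, smul_eq_mul, smul_eq_mul, OLag.pairing]
    ring
  rw [← h, exteriorPower.map_apply_ιMulti, exteriorPower.pairingDual_ιMulti_ιMulti,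
    ← Matrix.det_transpose]
  rfl

end Volume

/-! ### The relative discriminant of a pair of Lagrangians, modulo squares. -/

section Adapted

variable {K : Type v} [Field K] {n : ℕ} {V : SympSpace.{u} K n}

/-- Reindexing rows and columns differently changes both determinants by the same sign, which
cancels in the product. -/
theorem det_submatrix_mul_det_submatrix {ι κ R : Type*} [Fintype ι] [DecidableEq ι] [Fintype κ]
    [DecidableEq κ] [CommRing R] (M N : Matrix ι ι R) (e e' : κ ≃ ι) :
    (M.submatrix e e').det * (N.submatrix e e').det = M.det * N.det := by
  rw [← N.det_transpose, ← (N.submatrix e e').det_transpose, ← Matrix.det_mul, ← Matrix.det_mul,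
    Matrix.transpose_submatrix, Matrix.submatrix_mul_equiv, Matrix.det_submatrix_equiv_self]

/-- Bases of two subspaces `X` and `L` that share `r` vectors, such that the form is nondegenerate
on the others. -/
structure AdaptedBases (X L : Submodule K V) (r s : ℕ) where
  left : Basis (Fin r ⊕ Fin s) K X
  right : Basis (Fin r ⊕ Fin s) K L
  inl_eq : ∀ i, (left (Sum.inl i) : V) = right (Sum.inl i)
  det_ne_zero : Matrix.det (.of fun i j : Fin s =>
    V.form (left (Sum.inr i)) (right (Sum.inr j))) ≠ 0

namespace AdaptedBases

variable {X L : Submodule K V} {r s : ℕ}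

/-- The Gram matrix of the vectors that are not shared. -/
noncomputable def gram (A : AdaptedBases X L r s) : Matrix (Fin s) (Fin s) K :=
  .of fun i j => V.form (A.left (Sum.inr i)) (A.right (Sum.inr j))

/-- Pairing `v` with the unshared vectors of `X` gives zero and involves only its unshared
coordinates, through the invertible Gram matrix. -/
theorem repr_inr_eq_zero (A : AdaptedBases X L r s) (hX : IsLagrangian V X) (v : L)
    (hv : (v : V) ∈ X) (j : Fin s) : A.right.repr v (Sum.inr j) = 0 := by
  have h : A.gram.mulVec (fun j => A.right.repr v (Sum.inr j)) = 0 := by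
    funext i
    have h0 := hX.form_eq_zero (A.left (Sum.inr i)).2 hv
    have hv' : (v : V) = ∑ k, A.right.repr v k • (A.right k : V) := by
      conv_lhs => rw [← A.right.sum_repr v]
      simp [-Fintype.sum_sum_type, -Basis.sum_repr]
    rw [hv', map_sum, Fintype.sum_sum_type] at h0
    simp only [map_smul, smul_eq_mul] at h0
    have hz : ∀ k : Fin r, A.right.repr v (Sum.inl k) *
        V.form (A.left (Sum.inr i)) (A.right (Sum.inl k)) = 0 := fun k => by
      rw [← A.inl_eq, hX.form_eq_zero (A.left _).2 (A.left _).2, mul_zero]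
    rw [Finset.sum_eq_zero fun k _ => hz k, zero_add] at h0
    rw [Pi.zero_apply, ← h0]
    simp [Matrix.mulVec, dotProduct, gram, mul_comm]
  exact congrFun (Matrix.eq_zero_of_mulVec_eq_zero A.det_ne_zero h) j

theorem finrank_inf (A : AdaptedBases X L r s) (hX : IsLagrangian V X) :
    finrank K ↥(L ⊓ X) = r := by
  have hli : LinearIndependent K (fun i : Fin r => (A.right (Sum.inl i) : V)) :=
    (A.right.linearIndependent.map' L.subtype L.ker_subtype).comp _ Sum.inl_injective
  have : L ⊓ X = Submodule.span K (Set.range fun i : Fin r => (A.right (Sum.inl i) : V)) := by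
    apply le_antisymm
    · rintro v ⟨hvL, hvX⟩
      have hv' : v = ∑ k, A.right.repr ⟨v, hvL⟩ k • (A.right k : V) := by
        have := congrArg Subtype.val (A.right.sum_repr ⟨v, hvL⟩)
        simpa [-Fintype.sum_sum_type, -Basis.sum_repr] using this.symm
      rw [hv', Fintype.sum_sum_type]
      refine add_mem (sum_mem fun i _ => Submodule.smul_mem _ _ (Submodule.subset_span ⟨i, rfl⟩))
        (sum_mem fun j _ => ?_)
      rw [A.repr_inr_eq_zero hX ⟨v, hvL⟩ hvX j, zero_smul]
      exact zero_mem _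
    · rw [Submodule.span_le]
      rintro _ ⟨i, rfl⟩
      refine ⟨(A.right _).2, ?_⟩
      beta_reduce
      rw [← A.inl_eq]
      exact (A.left _).2
  rw [this, finrank_span_eq_card hli, Fintype.card_fin]

/-- Two adapted bases are interchanged by exchanging the subspaces. -/
noncomputable def symm (A : AdaptedBases X L r s) : AdaptedBases L X r s where
  left := A.right
  right := A.left
  inl_eq i := (A.inl_eq i).symm
  det_ne_zero := by
    have h : (Matrix.of fun i j : Fin s => V.form (A.right (Sum.inr i)) (A.left (Sum.inr j))) =
        -A.gram.transpose := by
      ext i j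
      exact V.form_swap _ _
    rw [h, Matrix.det_neg, Matrix.det_transpose]
    exact mul_ne_zero (pow_ne_zero _ (neg_ne_zero.mpr one_ne_zero)) A.det_ne_zero

/-- Both base changes preserve `X ∩ L`, so they are block triangular, with the same block on `X ∩
L`. The Gram matrix transforms by the two remaining blocks, so every block determinant occurs twice.
-/
theorem isSquare_det_mul (A A' : AdaptedBases X L r s) (hX : IsLagrangian V X)
    (hL : IsLagrangian V L) :
    IsSquare ((A.right.toMatrix A'.right).det * (A.left.toMatrix A'.left).det *
      (A.gram.det * A'.gram.det)) := by
  set P := A.right.toMatrix A'.right with hP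
  set R := A.left.toMatrix A'.left with hR
  have hmX : ∀ j, (A'.right (Sum.inl j) : V) ∈ X := fun j => A'.inl_eq j ▸ (A'.left _).2
  have hmL : ∀ j, (A'.left (Sum.inl j) : V) ∈ L := fun j => A'.inl_eq j ▸ (A'.right _).2
  have hP21 : P.toBlocks₂₁ = 0 := by
    ext i j
    exact A.repr_inr_eq_zero hX _ (hmX j) i
  have hR21 : R.toBlocks₂₁ = 0 := by
    ext i j
    exact A.symm.repr_inr_eq_zero hL _ (hmL j) i
  have hPs : ∀ j, (A'.right j : V) = ∑ k, P k j • (A.right k : V) := fun j => by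
    have := congrArg Subtype.val (A.right.sum_toMatrix_smul_self (v := A'.right) j)
    simpa [-Fintype.sum_sum_type, -Basis.sum_toMatrix_smul_self] using this.symm
  have hRs : ∀ j, (A'.left j : V) = ∑ k, R k j • (A.left k : V) := fun j => by
    have := congrArg Subtype.val (A.left.sum_toMatrix_smul_self (v := A'.left) j)
    simpa [-Fintype.sum_sum_type, -Basis.sum_toMatrix_smul_self] using this.symm
  have h11 : P.toBlocks₁₁ = R.toBlocks₁₁ := by
    ext i j
    have h1 : A'.right (Sum.inl j) = ∑ k, R (Sum.inl k) (Sum.inl j) • A.right (Sum.inl k) := by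
      apply Subtype.ext
      rw [← A'.inl_eq, hRs, Fintype.sum_sum_type]
      have : ∀ k, R (Sum.inr k) (Sum.inl j) = 0 := fun k => congrFun (congrFun hR21 k) j
      simp [this, A.inl_eq]
    change A.right.repr (A'.right (Sum.inl j)) (Sum.inl i) = R (Sum.inl i) (Sum.inl j)
    rw [h1]
    simp [Finsupp.single_apply]
  have hgram : A'.gram = R.toBlocks₂₂.transpose * A.gram * P.toBlocks₂₂ := by
    ext i j
    change V.form (A'.left (Sum.inr i)) (A'.right (Sum.inr j)) = _
    have hRf : V.form (A'.left (Sum.inr i)) = ∑ k, R k (Sum.inr i) • V.form (A.left k) := by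
      rw [hRs, map_sum]
      simp only [map_smul]
    rw [hPs, hRf, map_sum]
    simp only [map_smul, smul_eq_mul, LinearMap.sum_apply, LinearMap.smul_apply]
    simp only [Fintype.sum_sum_type]
    have e1 : ∀ k l, V.form (A.left (Sum.inl k)) (A.right l) = 0 := fun k l => by
      rw [A.inl_eq]
      exact hL.form_eq_zero (A.right _).2 (A.right _).2
    have e2 : ∀ k l, V.form (A.left k) (A.right (Sum.inl l)) = 0 := fun k l => by
      rw [← A.inl_eq]
      exact hX.form_eq_zero (A.left _).2 (A.left _).2
    simp only [e1, e2, mul_zero, Finset.sum_const_zero, zero_add, Matrix.mul_apply,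
      Matrix.transpose_apply, Finset.sum_mul]
    refine Finset.sum_congr rfl fun l _ => ?_
    rw [Finset.mul_sum]
    exact Finset.sum_congr rfl fun k _ => mul_comm _ _
  have hPd : P.det = P.toBlocks₁₁.det * P.toBlocks₂₂.det := by
    conv_lhs => rw [← P.fromBlocks_toBlocks, hP21, Matrix.det_fromBlocks_zero₂₁]
  have hRd : R.det = R.toBlocks₁₁.det * R.toBlocks₂₂.det := by
    conv_lhs => rw [← R.fromBlocks_toBlocks, hR21, Matrix.det_fromBlocks_zero₂₁]
  refine ⟨P.toBlocks₁₁.det * P.toBlocks₂₂.det * R.toBlocks₂₂.det * A.gram.det, ?_⟩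
  rw [hPd, hRd, hgram, Matrix.det_mul, Matrix.det_mul, Matrix.det_transpose, h11]
  ring

end AdaptedBases

/-- The values of the discriminant of the pair `(X, L)` in adapted bases. -/
def IsRelDisc (X L : OLag V) (d : K) : Prop :=
  ∃ (r s : ℕ) (ε : Fin r ⊕ Fin s ≃ Fin n) (A : AdaptedBases X.space L.space r s),
    d = L.vol (A.right ∘ ε.symm) * X.vol (A.left ∘ ε.symm) * A.gram.det

theorem IsRelDisc.ne_zero {X L : OLag V} {d : K} (h : IsRelDisc X L d) : d ≠ 0 := by
  obtain ⟨r, s, ε, A, rfl⟩ := h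
  have h1 := L.vol_basis_ne_zero (A.right.reindex ε)
  have h2 := X.vol_basis_ne_zero (A.left.reindex ε)
  rw [Basis.coe_reindex] at h1 h2
  exact mul_ne_zero (mul_ne_zero h1 h2) A.det_ne_zero

theorem IsRelDisc.isSquare_mul {X L : OLag V} {d d' : K} (h : IsRelDisc X L d)
    (h' : IsRelDisc X L d') : IsSquare (d * d') := by
  obtain ⟨r, s, ε, A, rfl⟩ := h
  obtain ⟨r', s', ε', A', rfl⟩ := h'
  obtain rfl : r = r' := by
    rw [← A.finrank_inf X.lagrangian, ← A'.finrank_inf X.lagrangian]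
  obtain rfl : s = s' := by
    have h1 := Fintype.card_congr ε
    have h2 := Fintype.card_congr ε'
    simp only [Fintype.card_sum, Fintype.card_fin] at h1 h2
    omega
  have e1 := L.vol_eq_mul_det (A.right.reindex ε) (A'.right.reindex ε')
  have e2 := X.vol_eq_mul_det (A.left.reindex ε) (A'.left.reindex ε')
  rw [Basis.det_apply] at e1 e2
  have e3 := det_submatrix_mul_det_submatrix ((A.right.reindex ε).toMatrix (A'.right.reindex ε'))
    ((A.left.reindex ε).toMatrix (A'.left.reindex ε')) ε ε'
  have e4 : ((A.right.reindex ε).toMatrix (A'.right.reindex ε')).submatrix ε ε' =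
      A.right.toMatrix A'.right := by
    ext i j
    simp [Basis.toMatrix_apply]
  have e5 : ((A.left.reindex ε).toMatrix (A'.left.reindex ε')).submatrix ε ε' =
      A.left.toMatrix A'.left := by
    ext i j
    simp [Basis.toMatrix_apply]
  rw [e4, e5] at e3
  obtain ⟨t, ht⟩ := A.isSquare_det_mul A' X.lagrangian L.lagrangian
  rw [e3] at ht
  simp only [Basis.coe_reindex] at e1 e2 ht
  refine ⟨L.vol (A.right ∘ ε.symm) * X.vol (A.left ∘ ε.symm) * t, ?_⟩
  rw [e1, e2]
  linear_combination (L.vol (A.right ∘ ε.symm) * X.vol (A.left ∘ ε.symm)) ^ 2 * ht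

/-- The relative discriminant in a pair of bases that diagonalize the form. -/
theorem isRelDisc_of_diagonal [DecidableEq K] {X L : OLag V} (c : Basis (Fin n) K X.space)
    (b : Basis (Fin n) K L.space) (θ : Fin n → K)
    (h : ∀ i j, V.form (c i) (b j) = if i = j then θ i else 0)
    (h0 : ∀ i, θ i = 0 → (c i : V) = b i) :
    IsRelDisc X L (L.vol b * X.vol c * ∏ i, if θ i = 0 then 1 else θ i) ∧
      finrank K ↥(L.space ⊓ X.space) = Fintype.card {i // θ i = 0} := by
  -- Indices with `θ i = 0` are the shared vectors; the others carry the nondegenerate diagonal Gram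
  -- matrix.
  let ε : Fin (Fintype.card {i // θ i = 0}) ⊕ Fin (Fintype.card {i // ¬θ i = 0}) ≃ Fin n :=
    (Equiv.sumCongr (Fintype.equivFin _).symm (Fintype.equivFin _).symm).trans
      (Equiv.sumCompl fun i => θ i = 0)
  have hl : ∀ i, θ (ε (Sum.inl i)) = 0 := fun i => ((Fintype.equivFin _).symm i).2
  have hr : ∀ i, θ (ε (Sum.inr i)) ≠ 0 := fun i => ((Fintype.equivFin _).symm i).2
  have hg : (Matrix.of fun i j => V.form ((c.reindex ε.symm) (Sum.inr i))
      ((b.reindex ε.symm) (Sum.inr j))) = Matrix.diagonal fun i => θ (ε (Sum.inr i)) := by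
    ext i j
    simp [h, Matrix.diagonal_apply]
  have hdet : ∏ i, θ (ε (Sum.inr i)) = ∏ i, if θ i = 0 then 1 else θ i := by
    rw [← ε.prod_comp, Fintype.prod_sum_type]
    simp [hl, hr]
  let A : AdaptedBases X.space L.space _ _ :=
    { left := c.reindex ε.symm
      right := b.reindex ε.symm
      inl_eq := fun i => by simpa using h0 _ (hl i)
      det_ne_zero := by
        rw [hg, Matrix.det_diagonal]
        exact Finset.prod_ne_zero_iff.mpr fun i _ => hr i }
  refine ⟨⟨_, _, ε, A, ?_⟩, A.finrank_inf X.lagrangian⟩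
  have h3 : A.gram.det = ∏ i, if θ i = 0 then 1 else θ i := by
    rw [← hdet, ← Matrix.det_diagonal, ← hg]
    rfl
  rw [h3]
  congr 3 <;> (funext i; simp [A])

end Adapted

/-! ### Quadratic Gauss sums and the one-dimensional identity. -/

section GaussSums

variable {K : Type v} [Field K] [Fintype K] [DecidableEq K] {ψ : AddChar K ℂ}

/-- The quadratic character with complex values. -/
noncomputable def quadraticCharComplex (K : Type v) [Field K] [Fintype K] [DecidableEq K] :
    MulChar K ℂ :=
  (quadraticChar K).ringHomComp (Int.castRingHom ℂ)

theorem quadraticCharComplex_apply (a : K) :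
    quadraticCharComplex K a = (quadraticChar K a : ℂ) := rfl

theorem quadraticCharComplex_sq {a : K} (ha : a ≠ 0) : quadraticCharComplex K a ^ 2 = 1 := by
  rw [quadraticCharComplex_apply]
  exact_mod_cast quadraticChar_sq_one ha

theorem quadraticCharComplex_eq_of_isSquare_mul {a b : K} (ha : a ≠ 0) (hb : b ≠ 0)
    (h : IsSquare (a * b)) : quadraticCharComplex K a = quadraticCharComplex K b := by
  have h1 : quadraticCharComplex K (a * b) = 1 := by
    obtain ⟨c, hc⟩ := h
    have hc0 : c ≠ 0 := by
      rintro rfl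
      exact mul_ne_zero ha hb (by simpa using hc)
    rw [hc, ← sq, map_pow, quadraticCharComplex_sq hc0]
  rw [map_mul] at h1
  linear_combination quadraticCharComplex K b * h1 -
    quadraticCharComplex K a * quadraticCharComplex_sq hb

theorem quadraticCharComplex_isQuadratic : (quadraticCharComplex K).IsQuadratic :=
  quadraticChar_isQuadratic K |>.comp _

theorem quadraticCharComplex_ne_one (hK : ringChar K ≠ 2) : quadraticCharComplex K ≠ 1 :=
  (MulChar.ringHomComp_ne_one_iff (Int.castRingHom ℂ).injective_int).mpr (quadraticChar_ne_one hK)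

/-- Each `t` has `σ(t) + 1` square roots, and the sum of `ψ` over `K` vanishes. -/
theorem sum_addChar_sq (hK : ringChar K ≠ 2) (hψ : ψ ≠ 1) :
    ∑ z : K, ψ (z ^ 2) = gaussSum (quadraticCharComplex K) ψ := by
  have h1 : ∑ z : K, ψ (z ^ 2) = ∑ t : K, ∑ z : K with z ^ 2 = t, ψ t := by
    rw [← Finset.sum_fiberwise (s := Finset.univ) (g := fun z : K => z ^ 2)]
    refine Finset.sum_congr rfl fun t _ => Finset.sum_congr rfl fun z hz => ?_
    rw [(Finset.mem_filter.mp hz).2]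
  have h2 : ∀ t : K, ∑ z : K with z ^ 2 = t, ψ t = (quadraticCharComplex K t + 1) * ψ t := by
    intro t
    rw [Finset.sum_const, nsmul_eq_mul, quadraticCharComplex_apply]
    congr 1
    have := quadraticChar_card_sqrts hK t
    rw [Set.toFinset_ofPred] at this
    exact_mod_cast this
  rw [h1, Finset.sum_congr rfl fun t _ => h2 t]
  simp only [add_mul, one_mul, Finset.sum_add_distrib]
  rw [AddChar.sum_eq_zero_of_ne_one hψ, add_zero, gaussSum]

theorem sum_addChar_mul_sq (hK : ringChar K ≠ 2) (hψ : ψ ≠ 1) {a : K} (ha : a ≠ 0) :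
    ∑ z : K, ψ (a * z ^ 2) = quadraticCharComplex K a * gaussSum (quadraticCharComplex K) ψ := by
  have h := sum_addChar_sq hK (AddChar.IsPrimitive.of_ne_one hψ ha)
  simp only [AddChar.mulShift_apply] at h
  have h' := gaussSum_mulShift_eq (quadraticCharComplex K) ψ (Units.mk0 a ha)
  rw [Units.val_mk0, quadraticCharComplex_isQuadratic.inv] at h'
  rw [h, h']

theorem sum_addChar_half_mul_sq (hK : ringChar K ≠ 2) (hψ : ψ ≠ 1) {a : K} (ha : a ≠ 0) :
    ∑ z : K, ψ (2⁻¹ * (a * z ^ 2)) = quadraticCharComplex K a * gaussSumOne ψ := by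
  have h2 : (2⁻¹ : K) ≠ 0 := inv_ne_zero (Ring.two_ne_zero hK)
  rw [gaussSumOne, sum_addChar_mul_sq hK hψ h2]
  simp only [← mul_assoc]
  rw [sum_addChar_mul_sq hK hψ (mul_ne_zero h2 ha), map_mul]
  ring

theorem gaussSumOne_sq (hK : ringChar K ≠ 2) (hψ : ψ ≠ 1) :
    gaussSumOne ψ ^ 2 = quadraticCharComplex K (-1) * Fintype.card K := by
  have h2 : (2⁻¹ : K) ≠ 0 := inv_ne_zero (Ring.two_ne_zero hK)
  rw [gaussSumOne, sum_addChar_mul_sq hK hψ h2, mul_pow, quadraticCharComplex_sq h2, one_mul,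
    gaussSum_sq (quadraticCharComplex_ne_one hK) quadraticCharComplex_isQuadratic
      (AddChar.IsPrimitive.of_ne_one hψ)]

theorem gaussSumOne_ne_zero (hK : ringChar K ≠ 2) (hψ : ψ ≠ 1) : gaussSumOne ψ ≠ 0 := by
  intro h
  have h1 := gaussSumOne_sq hK hψ
  have h2 := quadraticCharComplex_sq (K := K) (neg_ne_zero.mpr one_ne_zero)
  have h3 : (Fintype.card K : ℂ) ≠ 0 := by exact_mod_cast Fintype.card_ne_zero
  rw [h, zero_pow two_ne_zero, eq_comm, mul_eq_zero, or_iff_left h3] at h1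
  rw [h1, zero_pow two_ne_zero] at h2
  exact zero_ne_one h2

/-- The local factor of the composition of two averaging maps. -/
theorem sum_addChar_line (hK : ringChar K ≠ 2) (hψ : ψ ≠ 1) {x y : K}
    (hxy : x = 1 ∨ (x = 0 ∧ y = 1)) :
    gaussSumOne ψ / Fintype.card K * (if -y = 0 then (gaussSumOne ψ)⁻¹ else 1) *
        quadraticCharComplex K (if -y = 0 then 1 else -y) *
        (∑ b : K, ∑ a : K, if a * y = b * x then ψ (2⁻¹ * (a * b)) else 0) =
      (if x = 0 then (gaussSumOne ψ)⁻¹ * Fintype.card K else 1) := by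
  have hG := gaussSumOne_ne_zero hK hψ
  have hG2 := gaussSumOne_sq hK hψ
  have hq : (Fintype.card K : ℂ) ≠ 0 := by exact_mod_cast Fintype.card_ne_zero
  have hs := quadraticCharComplex_sq (K := K) (neg_ne_zero.mpr one_ne_zero)
  -- If `x = 1`, then `b = a * y` is forced: the double sum is `q` for `y = 0` and `σ(y) * G₁`
  -- otherwise. If `x = 0`, then `a = 0` is forced and `b` is free, so the sum is `q`.
  rcases hxy with rfl | ⟨rfl, rfl⟩
  · rw [Finset.sum_comm, if_neg one_ne_zero]
    simp only [mul_one]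
    have e : ∀ a : K, (∑ b : K, if a * y = b then ψ (2⁻¹ * (a * b)) else 0) =
        ψ (2⁻¹ * (y * a ^ 2)) := by
      intro a
      rw [Finset.sum_ite_eq, if_pos (Finset.mem_univ _)]
      congr 1
      ring
    simp only [e]
    by_cases hy : y = 0
    · simp [hy]
      field_simp
    · rw [if_neg (neg_ne_zero.mpr hy), if_neg (neg_ne_zero.mpr hy),
        sum_addChar_half_mul_sq hK hψ hy, ← neg_one_mul y, map_mul]
      have hy2 := quadraticCharComplex_sq hy
      field_simp
      linear_combination quadraticCharComplex K (-1) * quadraticCharComplex K y ^ 2 * hG2 +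
        quadraticCharComplex K (-1) ^ 2 * Fintype.card K * hy2 + Fintype.card K * hs
  · have e : ∀ b : K, (∑ a : K, if a * 1 = b * 0 then ψ (2⁻¹ * (a * b)) else 0) = 1 := by
      intro b
      simp
    simp only [e]
    rw [if_neg (by simp), if_neg (by simp), if_true]
    simp
    field_simp
    linear_combination quadraticCharComplex K (-1) * hG2 + Fintype.card K * hs

end GaussSums

/-! ### Composed averages in normal-form coordinates. -/

section NormalForm

variable {K : Type v} [Field K] {n : ℕ} {V : SympSpace.{u} K n}

theorem Module.Basis.coe_equivFun_symm {ι : Type*} [Fintype ι] {L : Submodule K V}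
    (b : Basis ι K L) (a : ι → K) : ((b.equivFun.symm a : L) : V) = ∑ i, a i • (b i : V) := by
  simp [Basis.equivFun_symm_apply]

theorem AddChar.apply_sum_eq_prod {ι A M : Type*} [AddCommMonoid A] [CommMonoid M]
    (φ : AddChar A M) (s : Finset ι) (a : ι → A) : φ (∑ i ∈ s, a i) = ∏ i ∈ s, φ (a i) := by
  classical
  induction s using Finset.induction_on with
  | empty => simp
  | insert i s hi ih => rw [Finset.sum_insert hi, Finset.prod_insert hi, φ.map_add_eq_mul, ih]

theorem form_left_of_normal_form {L M X : Submodule K V} (hL : IsLagrangian V L)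
    {e : Basis (Fin n) K L} {f : Basis (Fin n) K M}
    {g : Basis (Fin n) K X} {x y : Fin n → K}
    (hef : ∀ i j, V.form (e i) (f j) = if i = j then 1 else 0)
    (hg : ∀ i, (g i : V) = x i • (e i : V) + y i • (f i : V)) (i j : Fin n) :
    V.form (g i) (e j) = if i = j then -y i else 0 := by
  have e1 : V.form (g i) = x i • V.form (e i) + y i • V.form (f i) := by rw [hg]; simp
  rw [e1, LinearMap.add_apply, LinearMap.smul_apply, LinearMap.smul_apply,
    hL.form_eq_zero (e i).2 (e j).2, V.form_swap, hef]
  by_cases hij : i = j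
  · simp [hij]
  · simp [hij, Ne.symm hij]

theorem form_right_of_normal_form {L M X : Submodule K V} (hM : IsLagrangian V M)
    {e : Basis (Fin n) K L} {f : Basis (Fin n) K M}
    {g : Basis (Fin n) K X} {x y : Fin n → K}
    (hef : ∀ i j, V.form (e i) (f j) = if i = j then 1 else 0)
    (hg : ∀ i, (g i : V) = x i • (e i : V) + y i • (f i : V)) (i j : Fin n) :
    V.form (g i) (f j) = if i = j then x i else 0 := by
  have e1 : V.form (g i) = x i • V.form (e i) + y i • V.form (f i) := by rw [hg]; simp
  rw [e1, LinearMap.add_apply, LinearMap.smul_apply, LinearMap.smul_apply,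
    hM.form_eq_zero (f i).2 (f j).2, hef]
  simp

theorem mem_iff_of_normal_form {L M X : Submodule K V} (hL : IsLagrangian V L)
    (hM : IsLagrangian V M) (hX : IsLagrangian V X) {e : Basis (Fin n) K L} {f : Basis (Fin n) K M}
    {g : Basis (Fin n) K X} {x y : Fin n → K}
    (hef : ∀ i j, V.form (e i) (f j) = if i = j then 1 else 0)
    (hg : ∀ i, (g i : V) = x i • (e i : V) + y i • (f i : V)) (a b : Fin n → K) :
    ((e.equivFun.symm a : V) + (f.equivFun.symm b : V) ∈ X) ↔ ∀ i, a i * y i = b i * x i := by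
  have h1 : ∀ i, V.form (g i) ((e.equivFun.symm a : V) + (f.equivFun.symm b : V)) =
      b i * x i - a i * y i := by
    intro i
    rw [e.coe_equivFun_symm, f.coe_equivFun_symm]
    simp [form_left_of_normal_form hL hef hg, form_right_of_normal_form hM hef hg]
    ring
  constructor
  · intro h i
    have := h1 i
    rw [hX.form_eq_zero (g i).2 h] at this
    linear_combination this
  · intro h
    refine hX.mem_of_form_eq_zero fun w hw => ?_
    have hw' : w = ∑ i, g.repr ⟨w, hw⟩ i • (g i : V) := by
      have := congrArg Subtype.val (g.sum_repr ⟨w, hw⟩)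
      simpa [-Basis.sum_repr] using this.symm
    have h2 : V.form w = ∑ i, g.repr ⟨w, hw⟩ i • V.form (g i) := by
      conv_lhs => rw [hw']
      rw [map_sum]
      simp only [map_smul]
    rw [h2, LinearMap.sum_apply]
    refine Finset.sum_eq_zero fun i _ => ?_
    rw [LinearMap.smul_apply, h1, h, sub_self, smul_zero]

variable {ψ : AddChar K ℂ} [Fintype K] [DecidableEq K]

/-- In these coordinates both membership in `X` and the phase `ω(l, m) / 2` separate, so the sum
over `L × M` factors into sums over `K × K`. -/
theorem lagAvg_lagAvg_lagDelta_eq_prod {L M X : OLag V} {e : Basis (Fin n) K L.space}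
    {f : Basis (Fin n) K M.space} {g : Basis (Fin n) K X.space} {x y : Fin n → K}
    (hef : ∀ i j, V.form (e i) (f j) = if i = j then 1 else 0)
    (hg : ∀ i, (g i : V) = x i • (e i : V) + y i • (f i : V)) :
    (lagAvg ψ M L (lagAvg ψ L X (lagDelta ψ X))).1 1 =
      ∏ i, ∑ b : K, ∑ a : K, if a * y i = b * x i then ψ (2⁻¹ * (a * b)) else 0 := by
  have hval : ∀ a b : Fin n → K,
      (lagDelta ψ X).1 (⟨e.equivFun.symm a, 0⟩ * (⟨f.equivFun.symm b, 0⟩ * 1)) =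
      ∏ i, if a i * y i = b i * x i then ψ (2⁻¹ * (a i * b i)) else 0 := by
    intro a b
    rw [mul_one]
    have hm := mem_iff_of_normal_form L.lagrangian M.lagrangian X.lagrangian hef hg a b
    rw [Fintype.prod_ite_zero]
    split_ifs with h
    · rw [lagDelta_apply_of_mem (hm.mpr h)]
      have hω : V.form (e.equivFun.symm a : V) (f.equivFun.symm b : V) = ∑ i, a i * b i := by
        rw [e.coe_equivFun_symm, f.coe_equivFun_symm]
        simp [hef, mul_comm]
      rw [Heis.mul_cen, hω, Finset.mul_sum, zero_add, zero_add]
      exact AddChar.apply_sum_eq_prod ψ _ _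
    · exact lagDelta_apply_of_not_mem fun h' => h (hm.mp h')
  have hsum : ∀ b : Fin n → K, (lagAvg ψ L X (lagDelta ψ X)).1 (⟨f.equivFun.symm b, 0⟩ * 1) =
      ∑ a : Fin n → K, ∏ i, if a i * y i = b i * x i then ψ (2⁻¹ * (a i * b i)) else 0 := by
    intro b
    rw [lagAvg_apply, ← finsum_comp_equiv e.equivFun.symm.toEquiv, finsum_eq_sum_of_fintype]
    exact Finset.sum_congr rfl fun a _ => hval a b
  rw [lagAvg_apply, ← finsum_comp_equiv f.equivFun.symm.toEquiv, finsum_eq_sum_of_fintype]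
  simp only [Finset.prod_univ_sum, Fintype.piFinset_univ]
  exact Finset.sum_congr rfl fun b _ => hsum b

end NormalForm

/-! ### The scalar identity behind flatness. -/

section RelativeConstant

variable {K : Type v} [Field K] [Fintype K] [DecidableEq K] {n : ℕ} {V : SympSpace.{u} K n}
  {ψ : AddChar K ℂ}

/-- The constant by which the averaging map `ℋ_X → ℋ_L` has to be multiplied, expressed by a
relative discriminant `d` of `(X, L)`. -/
noncomputable def relConst (ψ : AddChar K ℂ) (X L : OLag V) (d : K) : ℂ :=
  (gaussSumOne ψ)⁻¹ ^ finrank K ↥(L.space ⊓ X.space) * quadraticCharComplex K d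

theorem pow_card_subtype_eq_prod {ι M : Type*} [Fintype ι] [CommMonoid M] (p : ι → Prop)
    [DecidablePred p] (a : M) : a ^ Fintype.card {i // p i} = ∏ i, if p i then a else 1 := by
  rw [Finset.prod_ite, Finset.prod_const, Finset.prod_const_one, mul_one, Fintype.card_subtype]

omit [Fintype K] in
theorem exists_isRelDisc (hK : ringChar K ≠ 2) (X L : OLag V) : ∃ d, IsRelDisc X L d := by
  have h2 := Ring.two_ne_zero hK
  obtain ⟨M, hM, hLM⟩ := exists_isLagrangian_sup_eq_top h2 L.lagrangian
  obtain ⟨e, f, g, x, y, hef, hg, hxy⟩ := exists_normal_form h2 L.lagrangian hM X.lagrangian hLM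
  have hge : ∀ i, -y i = 0 → (g i : V) = e i := fun i hi => by
    rw [neg_eq_zero] at hi
    rw [hg, (hxy i).resolve_right (by simp [hi]), hi, one_smul, zero_smul, add_zero]
  exact ⟨_, (isRelDisc_of_diagonal g e _ (form_left_of_normal_form L.lagrangian hef hg) hge).1⟩

/-- One normal form diagonalizes both pairs: `(X, L)` with entries `-y i` and `(X, M)` with entries
`x i`. The orientation factor of `L` occurs twice and drops out; the rest is a product of the local
identities. -/
theorem normConst_mul_relConst (hK : ringChar K ≠ 2) (hψ : ψ ≠ 1) {X L M : OLag V}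
    (hLM : L.space ⊔ M.space = ⊤) {dL dM : K} (hdL : IsRelDisc X L dL) (hdM : IsRelDisc X M dM) :
    normConst ψ M L * relConst ψ X L dL * (lagAvg ψ M L (lagAvg ψ L X (lagDelta ψ X))).1 1 =
      relConst ψ X M dM * Nat.card ↥(M.space ⊓ X.space) := by
  have h2 := Ring.two_ne_zero hK
  obtain ⟨e, f, g, x, y, hef, hg, hxy⟩ :=
    exists_normal_form h2 L.lagrangian M.lagrangian X.lagrangian hLM
  have hge : ∀ i, -y i = 0 → (g i : V) = e i := fun i hi => by
    rw [neg_eq_zero] at hi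
    rw [hg, (hxy i).resolve_right (by simp [hi]), hi, one_smul, zero_smul, add_zero]
  have hgf : ∀ i, x i = 0 → (g i : V) = f i := fun i hi => by
    rw [hg, ((hxy i).resolve_left (by simp [hi])).2, hi, one_smul, zero_smul, zero_add]
  obtain ⟨hL, hrL⟩ := isRelDisc_of_diagonal g e _
    (form_left_of_normal_form L.lagrangian hef hg) hge
  obtain ⟨hM, hrM⟩ := isRelDisc_of_diagonal g f _
    (form_right_of_normal_form M.lagrangian hef hg) hgf
  have hpair : quadraticCharComplex K (L.pairing M) =
      quadraticCharComplex K (L.vol e) * quadraticCharComplex K (M.vol f) := by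
    have h1 := L.vol_mul_vol_mul_pairing M e f
    have h3 : (Matrix.of fun i j => V.form (e i) (f j)) = (1 : Matrix (Fin n) (Fin n) K) := by
      ext i j
      rw [Matrix.of_apply, hef, Matrix.one_apply]
    rw [h3, Matrix.det_one] at h1
    have h4 := congrArg (quadraticCharComplex K) h1
    rw [map_mul, map_mul, map_one] at h4
    have he := quadraticCharComplex_sq (L.vol_basis_ne_zero e)
    have hf := quadraticCharComplex_sq (M.vol_basis_ne_zero f)
    linear_combination quadraticCharComplex K (L.vol e) * quadraticCharComplex K (M.vol f) * h4 -
      quadraticCharComplex K (L.pairing M) * quadraticCharComplex K (M.vol f) ^ 2 * he -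
      quadraticCharComplex K (L.pairing M) * hf
  have he := quadraticCharComplex_sq (L.vol_basis_ne_zero e)
  have hcL := quadraticCharComplex_eq_of_isSquare_mul hdL.ne_zero hL.ne_zero (hdL.isSquare_mul hL)
  have hcM := quadraticCharComplex_eq_of_isSquare_mul hdM.ne_zero hM.ne_zero (hdM.isSquare_mul hM)
  -- The nonzero `x i` are normalized to `1`, so the discriminant of `(X, M)` comes from the
  -- orientations alone.
  have hx1 : ∏ i, (if x i = 0 then 1 else x i) = 1 := by
    refine Finset.prod_eq_one fun i _ => ?_
    rcases hxy i with h | ⟨h, _⟩ <;> simp [h]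
  rw [hx1, mul_one] at hcM
  have hcard : (Nat.card ↥(M.space ⊓ X.space) : ℂ) =
      (Fintype.card K : ℂ) ^ Fintype.card {i // x i = 0} := by
    rw [← hrM, Module.natCard_eq_pow_finrank (K := K), Nat.card_eq_fintype_card, Nat.cast_pow]
  rw [relConst, relConst, hcL, hcM, hrL, hrM, hcard, normConst, ← quadraticCharComplex_apply, hpair,
    lagAvg_lagAvg_lagDelta_eq_prod hef hg, map_mul, map_mul, map_mul, map_prod]
  have key : (gaussSumOne ψ / Fintype.card K) ^ n *
      (gaussSumOne ψ)⁻¹ ^ Fintype.card {i // -y i = 0} *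
      (∏ i, quadraticCharComplex K (if -y i = 0 then 1 else -y i)) *
      (∏ i, ∑ b : K, ∑ a : K, if a * y i = b * x i then ψ (2⁻¹ * (a * b)) else 0) =
      (gaussSumOne ψ)⁻¹ ^ Fintype.card {i // x i = 0} *
        (Fintype.card K : ℂ) ^ Fintype.card {i // x i = 0} := by
    have hn : (gaussSumOne ψ / Fintype.card K) ^ n =
        ∏ _i : Fin n, gaussSumOne ψ / Fintype.card K := by
      rw [Finset.prod_const, Finset.card_univ, Fintype.card_fin]
    rw [← mul_pow, pow_card_subtype_eq_prod, pow_card_subtype_eq_prod, hn,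
      ← Finset.prod_mul_distrib, ← Finset.prod_mul_distrib, ← Finset.prod_mul_distrib]
    exact Finset.prod_congr rfl fun i _ => sum_addChar_line hK hψ (hxy i)
  linear_combination quadraticCharComplex K (L.vol e) ^ 2 * quadraticCharComplex K (M.vol f) *
    quadraticCharComplex K (X.vol g) * key + quadraticCharComplex K (M.vol f) *
    quadraticCharComplex K (X.vol g) * (gaussSumOne ψ)⁻¹ ^ Fintype.card {i // x i = 0} *
        (Fintype.card K : ℂ) ^ Fintype.card {i // x i = 0} * he

end RelativeConstant

/-! ### Uniqueness and existence of the trivialization. -/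

section Trivializations

variable {K : Type v} [Field K] {n : ℕ} {V : SympSpace.{u} K n} {ψ : AddChar K ℂ}

theorem IsLagrangian.exists_oLag {L : Submodule K V} (hL : IsLagrangian V L) :
    ∃ L' : OLag V, L'.space = L := by
  have h1 : 0 < finrank K (⋀[K]^n L) := by
    rw [exteriorPower.finrank_eq, hL.finrank_eq, Nat.choose_self]
    exact one_pos
  have := nontrivial_of_finrank_pos h1
  obtain ⟨o, ho⟩ := exists_ne (0 : ⋀[K]^n L)
  exact ⟨⟨L, hL, o, ho⟩, rfl⟩

theorem exists_oLag_common_transversal (h2 : (2 : K) ≠ 0) (M L : OLag V) :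
    ∃ N : OLag V, N.space ⊔ M.space = ⊤ ∧ L.space ⊔ N.space = ⊤ := by
  obtain ⟨N, hN, h1, h3⟩ := exists_common_transversal h2 L.lagrangian M.lagrangian
  obtain ⟨N', rfl⟩ := hN.exists_oLag
  exact ⟨N', by rw [sup_comm, h3], h1⟩

theorem Trivialization.apply_apply (T : Trivialization V ψ) (N M L : OLag V)
    (f : lagModel V ψ L) : T.E N M (T.E M L f) = T.E N L f :=
  DFunLike.congr_fun (T.comp N M L) f

theorem Trivialization.ext_apply {T T' : Trivialization V ψ}
    (h : ∀ M L f, T.E M L f = T'.E M L f) : T = T' := by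
  obtain ⟨E, hE⟩ := T
  obtain ⟨E', hE'⟩ := T'
  obtain rfl : E = E' := funext fun M => funext fun L => DFunLike.ext _ _ fun f => h M L f
  rfl

variable [Fintype K] [DecidableEq K]

theorem Trivialization.IsCanonical.unique (h2 : (2 : K) ≠ 0) {T T' : Trivialization V ψ}
    (hT : T.IsCanonical) (hT' : T'.IsCanonical) : T = T' := by
  have key : ∀ M L, L.space ⊔ M.space = ⊤ → ∀ f, T.E M L f = T'.E M L f := fun M L h f =>
    Subtype.ext (funext fun x => by rw [hT M L h, hT' M L h])
  refine Trivialization.ext_apply fun M L f => ?_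
  obtain ⟨N, hNM, hLN⟩ := exists_oLag_common_transversal h2 M L
  rw [← T.apply_apply M N L, ← T'.apply_apply M N L, key N L hLN, key M N hNM]

theorem relConst_ne_zero (hK : ringChar K ≠ 2) (hψ : ψ ≠ 1) {X L : OLag V} {d : K} (hd : d ≠ 0) :
    relConst ψ X L d ≠ 0 := by
  refine mul_ne_zero (pow_ne_zero _ (inv_ne_zero (gaussSumOne_ne_zero hK hψ))) fun h => ?_
  have := quadraticCharComplex_sq hd
  rw [h, zero_pow two_ne_zero] at this
  exact zero_ne_one this

/-- Both sides are intertwiners in `f`, so it suffices to compare them at `lagDelta ψ X` and `1`,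
where the identity is `normConst_mul_relConst`. -/
theorem exists_flat_section (hK : ringChar K ≠ 2) (hψ : ψ ≠ 1) (X : OLag V) :
    ∃ t : ∀ L : OLag V, (lagRep V ψ X).Equiv (lagRep V ψ L),
      ∀ M L, L.space ⊔ M.space = ⊤ → ∀ f, normConst ψ M L • lagAvg ψ M L (t L f) = t M f := by
  have h2 := Ring.two_ne_zero hK
  choose d hd using exists_isRelDisc hK X
  have hc : ∀ L, relConst ψ X L (d L) ≠ 0 := fun L => relConst_ne_zero hK hψ (hd L).ne_zero
  let t : ∀ L : OLag V, (lagRep V ψ X).Equiv (lagRep V ψ L) := fun L =>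
    Representation.Equiv.mk
      ((LinearEquiv.ofBijective (lagAvg ψ L X).toLinearMap (lagAvg_bijective h2 hψ L X)).trans
        (LinearEquiv.smulOfNeZero ℂ _ _ (hc L)))
      (fun g => LinearMap.ext fun f => by
        change relConst ψ X L (d L) • lagAvg ψ L X (lagRep V ψ X g f) =
          lagRep V ψ L g (relConst ψ X L (d L) • lagAvg ψ L X f)
        rw [map_smul, Representation.IntertwiningMap.isIntertwining])
  have ht : ∀ L f, t L f = relConst ψ X L (d L) • lagAvg ψ L X f := fun _ _ => rfl
  refine ⟨t, fun M L hLM f => ?_⟩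
  have hφ : ∃ φ : (lagRep V ψ X).IntertwiningMap (lagRep V ψ M),
      ∀ f, φ f = normConst ψ M L • lagAvg ψ M L (t L f) := by
    refine ⟨LinearMap.intertwiningMap_of_isIntertwiningMap _ _
      (normConst ψ M L • (lagAvg ψ M L).toLinearMap ∘ₗ (t L).toIntertwiningMap.toLinearMap)
      fun g f => ?_, fun f => rfl⟩
    change normConst ψ M L • lagAvg ψ M L ((t L).toIntertwiningMap (lagRep V ψ X g f)) =
      lagRep V ψ M g (normConst ψ M L • lagAvg ψ M L ((t L).toIntertwiningMap f))
    rw [Representation.IntertwiningMap.isIntertwining,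
      Representation.IntertwiningMap.isIntertwining, map_smul]
  obtain ⟨φ, hφ⟩ := hφ
  have heq : φ = (t M).toIntertwiningMap := by
    refine intertwiningMap_ext h2 hψ ?_
    have hnum := normConst_mul_relConst hK hψ hLM (hd L) (hd M)
    rw [← lagAvg_lagDelta (ψ := ψ)] at hnum
    rw [hφ, ht, map_smul, smul_smul]
    exact hnum
  rw [← hφ, heq]
  rfl

theorem exists_isCanonical (hK : ringChar K ≠ 2) (hψ : ψ ≠ 1) (V : SympSpace.{u} K n) :
    ∃ T : Trivialization V ψ, T.IsCanonical := by
  -- Without oriented Lagrangians there is nothing to define; otherwise any `X` serves as base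
  -- point.
  rcases isEmpty_or_nonempty (OLag V) with h | ⟨⟨X⟩⟩
  · exact ⟨⟨fun M => isEmptyElim M, fun M => isEmptyElim M⟩, fun M => isEmptyElim M⟩
  · obtain ⟨t, ht⟩ := exists_flat_section hK hψ X
    refine ⟨⟨fun M L => (t L).symm.trans (t M), fun N M L => DFunLike.ext _ _ fun f => ?_⟩,
      fun M L hLM f h => ?_⟩
    · change t N ((t M).symm (t M ((t L).symm f))) = t N ((t L).symm f)
      rw [Representation.Equiv.symm_apply_apply]
    · change (t M ((t L).symm f)).1 h = _
      rw [← ht M L hLM, Representation.Equiv.apply_symm_apply]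
      rfl

end Trivializations

/-! ### Compatibility with symplectic isomorphisms. -/

section Naturality

variable {K : Type v} [Field K] {n : ℕ} {V W : SympSpace.{u} K n} {ψ : AddChar K ℂ}

theorem OLag.map_sup_eq_top (f : V.Iso W) {L M : OLag V} (h : L.space ⊔ M.space = ⊤) :
    (L.map f).space ⊔ (M.map f).space = ⊤ := by
  change L.space.map _ ⊔ M.space.map _ = ⊤
  rw [← Submodule.map_sup, h, Submodule.map_top]
  exact LinearEquiv.range f.toLinearEquiv

/-- Transporting bases along `f` preserves both their volumes and their Gram matrix, and these
determine the pairing. -/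
theorem OLag.pairing_map (f : V.Iso W) (L M : OLag V) :
    (L.map f).pairing (M.map f) = L.pairing M := by
  have hf : ∀ x y, W.form (f.toLinearEquiv x) (f.toLinearEquiv y) = V.form x y := f.map_app'
  let b : Basis (Fin n) K L.space := finBasisOfFinrankEq K L.space L.lagrangian.finrank_eq
  let c : Basis (Fin n) K M.space := finBasisOfFinrankEq K M.space M.lagrangian.finrank_eq
  have hvol : ∀ (N : OLag V) (b : Basis (Fin n) K N.space),
      (N.map f).vol (f.toLinearEquiv.submoduleMap N.space ∘ b) = N.vol b := by
    intro N b
    have h1 := (N.map f).ιMulti_eq_vol_smul (f.toLinearEquiv.submoduleMap N.space ∘ b)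
    have h2 := congrArg (exteriorPower.map n (f.toLinearEquiv.submoduleMap N.space).toLinearMap)
      (N.ιMulti_eq_vol_smul b)
    rw [exteriorPower.map_apply_ιMulti, map_smul] at h2
    exact smul_left_injective K (N.map f).orient_ne_zero (h1.symm.trans h2)
  have h1 := (L.map f).vol_mul_vol_mul_pairing (M.map f)
    (f.toLinearEquiv.submoduleMap L.space ∘ b) (f.toLinearEquiv.submoduleMap M.space ∘ c)
  rw [hvol, hvol] at h1
  have h2 : (Matrix.of fun i j => W.form ((f.toLinearEquiv.submoduleMap L.space ∘ b) i : W)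
      ((f.toLinearEquiv.submoduleMap M.space ∘ c) j : W)) =
      Matrix.of fun i j => V.form (b i) (c j) := by
    ext i j
    exact hf _ _
  have h3 := L.vol_mul_vol_mul_pairing M b c
  rw [← h2] at h3
  exact mul_left_cancel₀ (mul_ne_zero (L.vol_basis_ne_zero b) (M.vol_basis_ne_zero c))
    (h1.trans h3.symm)

variable [Fintype K] [DecidableEq K]

/-- In general position both sides are explicit: the constants agree by `OLag.pairing_map`, and `f`
reindexes the sum over `M` as one over `f(M)`. -/
theorem pullback_apply_of_sup_eq_top {T : Trivialization V ψ} {T' : Trivialization W ψ}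
    (hT : T.IsCanonical) (hT' : T'.IsCanonical) (f : V.Iso W) {M L : OLag V}
    (h : L.space ⊔ M.space = ⊤) (φ : lagModel W ψ (L.map f)) :
    T.E M L (pullback ψ f L φ) = pullback ψ f M (T'.E (M.map f) (L.map f) φ) := by
  apply Subtype.ext
  funext x
  rw [hT M L h]
  change _ = (T'.E (M.map f) (L.map f) φ).1 (Heis.map f x)
  rw [hT' _ _ (OLag.map_sup_eq_top f h), normConst, normConst, OLag.pairing_map]
  congr 1
  refine Eq.trans ?_ (finsum_comp_equiv (f.toLinearEquiv.submoduleMap M.space).toEquiv)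
  refine finsum_congr fun m => ?_
  change φ.1 (Heis.map f (⟨m, 0⟩ * x)) = _
  rw [map_mul]
  rfl

theorem Trivialization.IsCanonical.pullback_apply (h2 : (2 : K) ≠ 0) {T : Trivialization V ψ}
    {T' : Trivialization W ψ} (hT : T.IsCanonical) (hT' : T'.IsCanonical) (f : V.Iso W)
    (M L : OLag V) (φ : lagModel W ψ (L.map f)) :
    T.E M L (pullback ψ f L φ) = pullback ψ f M (T'.E (M.map f) (L.map f) φ) := by
  obtain ⟨N, hNM, hLN⟩ := exists_oLag_common_transversal h2 M L
  rw [← T.apply_apply M N L, ← T'.apply_apply _ (N.map f) _,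
    pullback_apply_of_sup_eq_top hT hT' f hLN, pullback_apply_of_sup_eq_top hT hT' f hNM]

end Naturality

theorem mainTheorem1 {K : Type v} [Field K] [Fintype K] [DecidableEq K] (hK : ringChar K ≠ 2)
    (ψ : AddChar K ℂ) (hψ : ψ ≠ 1) (n : ℕ) :
    ∃ T : ∀ V : SympSpace.{u} K n, Trivialization V ψ,
      IsNaturalSystem T ∧
      ∀ V : SympSpace.{u} K n, (T V).IsCanonical ∧
        ∀ T' : Trivialization V ψ, T'.IsCanonical → T' = T V := by
  have h2 := Ring.two_ne_zero hK
  choose T hT using exists_isCanonical (n := n) hK hψ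
  exact ⟨T, fun V W f M L φ => (hT V).pullback_apply h2 (hT W) f M L φ,
    fun V => ⟨hT V, fun T' hT' => hT'.unique h2 (hT V)⟩⟩
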